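/- Let $\mathbb{Z}\langle \mathbf a,\mathbf b\rangle$ be the ring of polynomials in two noncommuting variables, and let $\mathbb{Z}\langle \mathbf c,\mathbf d\rangle$ be its subring generated by $\mathbf c=\mathbf a+\mathbf b$ and $\mathbf d=\mathbf a\mathbf b+\mathbf b\mathbf a$. For a finite graded poset $P$ of rank $n+1$ with minimum $\hat 0$ and maximum $\hat 1$ let $\Psi(P)=\sum_{S\subseteq\{1,\dots,n\}}h_S\,u_S$ be its $\mathbf a\mathbf b$-index, where $h_S=\sum_{T\subseteq S}(-1)^{|S\setminus T|}f_T$, $f_T$ is the number of chains from $\hat 0$ to $\hat 1$ whose other elements have ranks exactly the elements of $T$, and $u_S=u_1\cdots u_n$ with $u_i=\mathbf b$ if $i\in S$ and $u_i=\mathbf a$ if $i\notin S$. Let $P\diamond Q=(P\setminus\{\hat 0\})\times(Q\setminus\{\hat 0\})\cup\{\hat 0\}$, and let $\diamond$ also denote the bilinear operator on polynomials with $\Psi(P\diamond Q)=\Psi(P)\diamond\Psi(Q)$ for all such $P$ and $Q$. Let $u$ and $v$ be $\mathbf c\mathbf d$-monomials of degrees $p$ and $q$, where $\mathbf c$ has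 degree $1$ and $\mathbf d$ has degree $2$. Label the horizontal axis from $0$ to $p$ by the letters of $u$ and the vertical axis from $0$ to $q$ by the letters of $v$, each $\mathbf c$ covering one unit interval and each $\mathbf d$ two consecutive ones (its first and second part on the horizontal axis, its bottom and top half on the vertical axis). A step of a lattice path is above the horizontal labels over which it runs and to the right of the vertical labels along which it runs. Let $\Gamma(u,v)$ be the set of lattice paths from $(0,0)$ to $(p,q)$, written as words in the steps $R=(1,0)$, $U=(0,1)$, $D=(1,1)$, $\overline R=(2,0)$, $\overline U=(0,2)$, which contain none of $UR$, $U\overline R$, $\overline UR$, $\overline U\,\overline R$ as a factor and satisfy: 1. No $U$ step is at the bottom half of a $\mathbf d$ label on the vertical axis. 2. No two consecutive $R$ steps run along the two parts of one $\mathbf d$ label on the horizontal axis. 3. Each $\overline U$ step starts at the bottom of a $\mathbf d$ label on the vertical axis, and each $\overline R$ step starts at the left end of a $\mathbf d$ label on the horizontal axis. 4. If a $D$ step is at the bottom half of a $\mathbf d$ label on the vertical axis, then there are no consecutive steps $DR$ for which the two steps run above the first and second part of one $\mathbf d$ label on the horizontal axis and this $D$ runs through the top half of the same vertical $\mathbf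 d$ label. The weight $\operatorname{wt}_{u,v}(P)\in\mathbb{Z}\langle \mathbf c,\mathbf d\rangle$ of a path $P$ is the product, in the order of the path, of the weights of its steps: $R$ and $U$ have weight $\mathbf c$, $\overline R$ and $\overline U$ have weight $\mathbf d$, and a step $D$ has weight $k\mathbf d$, where $k=2$ if $D$ is - above a $\mathbf c$ label and to the right of a $\mathbf c$ label or of the bottom half of a $\mathbf d$ label, or - above the first part of a $\mathbf d$ label, to the right of a $\mathbf c$ label, and immediately followed by a $U$, $\overline U$ or $D$ step, or - above the first part of a $\mathbf d$ label, to the right of the bottom half of a $\mathbf d$ label, and immediately followed by a $U$ step, and $k=1$ otherwise. Then $$u\diamond v=\sum_{P\in\Gamma(u,v)}\operatorname{wt}_{u,v}(P).$$ -/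

import Mathlib

noncomputable section

namespace CDDiamond

/-! ## Noncommutative polynomials -/

/-- The two noncommuting variables `a` and `b`. -/
inductive AB
  | a
  | b

/-- `ℤ⟨a, b⟩`. -/
abbrev ABPoly : Type := MonoidAlgebra ℤ (FreeMonoid AB)

/-- The variable `a`. -/
def va : ABPoly := MonoidAlgebra.of ℤ (FreeMonoid AB) (FreeMonoid.of AB.a)

/-- The variable `b`. -/
def vb : ABPoly := MonoidAlgebra.of ℤ (FreeMonoid AB) (FreeMonoid.of AB.b)

/-- `c = a + b`. The ring `ℤ⟨c, d⟩` is the subring of `ℤ⟨a, b⟩` generated by `c` and `d`. -/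
def vc : ABPoly := va + vb

/-- `d = a b + b a`. -/
def vd : ABPoly := va * vb + vb * va

/-- The monomial in `a` and `b` spelled by a word. -/
def abWord (w : List AB) : ABPoly := MonoidAlgebra.of ℤ (FreeMonoid AB) (FreeMonoid.ofList w)

/-! ## The diamond product of polynomials

For a graded poset `P` of rank `n + 1` the `ab`-index is
`Ψ(P) = ∑ S, h_S • u_S`. Substituting `a + b` for `a` turns it into the flag
`f`-polynomial `∑ S, f_S • u_S`, which enumerates the chains of `P`: a chain of elements
strictly between `0` and `1` contributes the word of length `n` with `b` at the ranks occupied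
by the chain and `a` at the other ranks.

Chains of `P ⋄ Q` are then counted as follows. Fix a chain in `P` and a chain in `Q`
(both ending at the maximal element). The chains `(x₁, y₁) < ⋯ < (x_k, y_k) = (1, 1)` of
`P ⋄ Q` whose projections are these two chains start at the pair of the first elements,
and each of their steps advances in the first chain, in the second chain, or in both; the rank
of `(x, y)` is `ρ(x) + ρ(y) - 1`. Reading the words of the two chains from left to right, this is
the recursion `flagWord`. The theorem `abIndex_diamondPoset` below shows that the operator
obtained in this way satisfies `Ψ(P ⋄ Q) = Ψ(P) ⋄ Ψ(Q)`. -/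

/-- The product of two monomials on the level of flag `f`-polynomials. -/
def flagWord : List AB → List AB → ABPoly
  | [], v => abWord v
  | u, [] => abWord u
  | AB.a :: u, v => va * flagWord u v
  | AB.b :: u, AB.a :: v => va * flagWord (AB.b :: u) v
  | AB.b :: u, AB.b :: v =>
      vb * flagWord u (AB.b :: v) + vb * flagWord (AB.b :: u) v + vb * va * flagWord u v
termination_by u v => u.length + v.length

/-- The bilinear extension of `flagWord`. -/
def flagDiamond : ABPoly →ₗ[ℤ] ABPoly →ₗ[ℤ] ABPoly :=
  (MonoidAlgebra.basis (FreeMonoid AB) ℤ).constr ℤ fun u =>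
    (MonoidAlgebra.basis (FreeMonoid AB) ℤ).constr ℤ fun v => flagWord u.toList v.toList

/-- The substitution `a ↦ a + b`, `b ↦ b`, from `Ψ` to the flag `f`-polynomial. -/
def toFlag : ABPoly →ₐ[ℤ] ABPoly :=
  MonoidAlgebra.lift ℤ ABPoly (FreeMonoid AB) (FreeMonoid.lift fun
    | AB.a => va + vb
    | AB.b => vb)

/-- The inverse substitution `a ↦ a - b`, `b ↦ b`. -/
def ofFlag : ABPoly →ₐ[ℤ] ABPoly :=
  MonoidAlgebra.lift ℤ ABPoly (FreeMonoid AB) (FreeMonoid.lift fun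
    | AB.a => va - vb
    | AB.b => vb)

/-- The diamond product of polynomials: the bilinear operator with
`Ψ(P ⋄ Q) = Ψ(P) ⋄ Ψ(Q)` for graded posets `P` and `Q`. -/
def diamond : ABPoly →ₗ[ℤ] ABPoly →ₗ[ℤ] ABPoly :=
  (flagDiamond.compl₁₂ toFlag.toLinearMap toFlag.toLinearMap).compr₂ ofFlag.toLinearMap

/-! ## Monomials in `c` and `d`, and the labels of the axes -/

/-- The letters of `cd`-monomials. -/
inductive CD
  | c
  | d

/-- The element of `ℤ⟨a, b⟩` given by a `cd`-monomial, a word in `c` and `d`. -/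
def cdWord (u : List CD) : ABPoly :=
  (u.map fun
    | CD.c => vc
    | CD.d => vd).prod

/-- The label of a unit interval of an axis. A letter `d` covers two consecutive unit intervals. -/
inductive Label
  | c
  | dFirst
  | dSecond

/-- The labels of the unit intervals `[0,1], [1,2], …` of an axis labeled by a `cd`-monomial. -/
def labels : List CD → List Label
  | [] => []
  | CD.c :: u => Label.c :: labels u
  | CD.d :: u => Label.dFirst :: Label.dSecond :: labels u

/-- The degree of a `cd`-monomial, `c` of degree one and `d` of degree two. -/
def deg : List CD → ℕ
  | [] => 0
  | CD.c :: u => deg u + 1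
  | CD.d :: u => deg u + 2

/-- `HasLabel u i ℓ`: on an axis labeled by `u`, the unit interval `[i, i + 1]` carries `ℓ`. -/
def HasLabel (u : List CD) (i : ℕ) (ℓ : Label) : Prop := (labels u)[i]? = some ℓ

/-! ## Lattice paths -/

/-- The steps of lattice paths. -/
inductive Step
  | R
  | U
  | D
  | Rbar
  | Ubar

/-- The vector of a step. -/
def Step.vec : Step → ℕ × ℕ
  | Step.R => (1, 0)
  | Step.U => (0, 1)
  | Step.D => (1, 1)
  | Step.Rbar => (2, 0)
  | Step.Ubar => (0, 2)

/-- The point reached from the origin by a path. -/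
def endpoint (P : List Step) : ℕ × ℕ := (P.map Step.vec).sum

/-- `P ∈ Γ(p, q)`: paths from the origin to `(p, q)` which do not contain any of the factors
`U R`, `U Rbar`, `Ubar R`, `Ubar Rbar`. -/
structure IsPath (p q : ℕ) (P : List Step) : Prop where
  endpoint_eq : endpoint P = (p, q)
  no_factor : ∀ (A B : List Step) (s t : Step), P = A ++ s :: t :: B →
    s = Step.U ∨ s = Step.Ubar → ¬ (t = Step.R ∨ t = Step.Rbar)

/-- `P ∈ Γ(u, v)`, the horizontal axis being labeled by `u` and the vertical axis by `v`.
When `P = A ++ s :: B`, the step `s` starts at the point `endpoint A`. -/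
structure IsLabeledPath (u v : List CD) (P : List Step) : Prop where
  isPath : IsPath (deg u) (deg v) P
  /-- no `U` at the bottom of a `d` on the vertical axis -/
  rule_one : ∀ A B : List Step, P = A ++ Step.U :: B →
    ¬ HasLabel v (endpoint A).2 Label.dFirst
  /-- no two consecutive `R` along a `d` on the horizontal axis -/
  rule_two : ∀ A B : List Step, P = A ++ Step.R :: Step.R :: B →
    ¬ HasLabel u (endpoint A).1 Label.dFirst
  /-- `Ubar` only at the bottom of a `d` on the vertical axis -/
  rule_three_up : ∀ A B : List Step, P = A ++ Step.Ubar :: B →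
    HasLabel v (endpoint A).2 Label.dFirst
  /-- `Rbar` only at the left of a `d` on the horizontal axis -/
  rule_three_right : ∀ A B : List Step, P = A ++ Step.Rbar :: B →
    HasLabel u (endpoint A).1 Label.dFirst
  /-- if a `D` is at the bottom of a `d` on the vertical axis, then no `D R` above a `d` on the
  horizontal axis and within the top half of this `d` on the vertical axis -/
  rule_four : ∀ A B C : List Step, P = A ++ Step.D :: B ++ Step.D :: Step.R :: C →
    HasLabel v (endpoint A).2 Label.dFirst →
    (endpoint (A ++ Step.D :: B)).2 = (endpoint A).2 + 1 →
    ¬ HasLabel u (endpoint (A ++ Step.D :: B)).1 Label.dFirst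

/-- The set `Γ(u, v)`. -/
def Gamma (u v : List CD) : Set (List Step) := {P | IsLabeledPath u v P}

open Classical in
/-- The coefficient `k` of a step `D` which starts at `(x, y)`, where `next` is the step after it
(`none` at the end of the path). -/
def diagCoeff (u v : List CD) (x y : ℕ) (next : Option Step) : ℤ :=
  if HasLabel u x Label.c ∧ (HasLabel v y Label.c ∨ HasLabel v y Label.dFirst) then 2
  else if HasLabel u x Label.dFirst ∧ HasLabel v y Label.c ∧
      (next = some Step.U ∨ next = some Step.Ubar ∨ next = some Step.D) then 2
  else if HasLabel u x Label.dFirst ∧ HasLabel v y Label.dFirst ∧ next = some Step.U then 2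
  else 1

/-- The weight of a step which starts at `(x, y)` and is followed by `next`. -/
def stepWeight (u v : List CD) (x y : ℕ) (next : Option Step) : Step → ABPoly
  | Step.R => vc
  | Step.U => vc
  | Step.Rbar => vd
  | Step.Ubar => vd
  | Step.D => diagCoeff u v x y next • vd

/-- The product of the weights of the steps of a path which starts at the point `z`. -/
def weightFrom (u v : List CD) : ℕ × ℕ → List Step → ABPoly
  | _, [] => 1
  | z, s :: P => stepWeight u v z.1 z.2 P.head? s * weightFrom u v (z + s.vec) P

/-- The weight of a path which starts at the origin. -/
def weight (u v : List CD) (P : List Step) : ABPoly := weightFrom u v (0, 0) P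

instance : Finite Step := by
  refine Finite.of_injective
    (fun s : Step => match s with
      | Step.R => (0 : Fin 5)
      | Step.U => 1
      | Step.D => 2
      | Step.Rbar => 3
      | Step.Ubar => 4) ?_
  intro s t h
  cases s <;> cases t <;> simp_all

theorem length_le_endpoint (P : List Step) :
    P.length ≤ (endpoint P).1 + (endpoint P).2 := by
  induction P with
  | nil => simp
  | cons s P ih =>
    have h : endpoint (s :: P) = s.vec + endpoint P := by simp [endpoint]
    rw [h]
    cases s <;> simp [Step.vec] <;> omega

theorem gamma_finite (u v : List CD) : (Gamma u v).Finite := by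
  refine (List.finite_length_le Step (deg u + deg v)).subset ?_
  intro P hP
  have h := length_le_endpoint P
  rw [hP.isPath.endpoint_eq] at h
  exact h


/-! ## The diamond product of posets -/

section Posets

variable {P : Type*} [PartialOrder P]

/-- The entry `f_S` of the flag `f`-vector of a poset with rank function `ρ`: the number of chains
whose elements have ranks exactly the elements of `S`. (For `S ⊆ {1, …, n}` these are the chains
from `0` to `1` with these inner ranks, the elements `0` and `1` being left out.) -/
def flagF (ρ : P → ℕ) (S : Finset ℕ) : ℕ :=
  {C : Finset P | IsChain (· ≤ ·) (C : Set P) ∧ C.image ρ = S}.ncard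

/-- The entry `h_S` of the flag `h`-vector. -/
def flagH (ρ : P → ℕ) (S : Finset ℕ) : ℤ :=
  ∑ T ∈ S.powerset, (-1) ^ (S \ T).card * (flagF ρ T : ℤ)

/-- The monomial `u_S` with `b` at the places of `l` which are in `S` and `a` at the others. -/
def setWord (l : List ℕ) (S : Finset ℕ) : ABPoly :=
  (l.map fun i => if i ∈ S then vb else va).prod

/-- The `ab`-index `Ψ(P)` of a poset of rank `n + 1` with rank function `ρ`. -/
def abIndex (ρ : P → ℕ) (n : ℕ) : ABPoly :=
  ∑ S ∈ (Finset.Icc 1 n).powerset, flagH ρ S • setWord (List.range' 1 n) S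

end Posets

/-- The diamond product `(P - {0}) × (Q - {0}) ∪ {0}`. -/
abbrev DiamondPoset (P Q : Type*) [PartialOrder P] [OrderBot P] [PartialOrder Q] [OrderBot Q] :
    Type _ :=
  WithBot ({x : P // x ≠ ⊥} × {y : Q // y ≠ ⊥})

/-- The rank function of the diamond product. -/
def diamondRank {P Q : Type*} [PartialOrder P] [OrderBot P] [PartialOrder Q] [OrderBot Q]
    (ρ : P → ℕ) (σ : Q → ℕ) : DiamondPoset P Q → ℕ
  | ⊥ => 0
  | WithBot.some z => ρ z.1 + σ z.2 - 1

/-! ### Properties of `flagDiamond` -/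

theorem basis_apply (w : FreeMonoid AB) :
    MonoidAlgebra.basis (FreeMonoid AB) ℤ w = abWord w.toList := by
  simp [abWord]

theorem flagDiamond_word (u v : List AB) :
    flagDiamond (abWord u) (abWord v) = flagWord u v := by
  have hu := basis_apply (FreeMonoid.ofList u)
  have hv := basis_apply (FreeMonoid.ofList v)
  simp only [FreeMonoid.toList_ofList] at hu hv
  rw [← hu, ← hv, flagDiamond, Module.Basis.constr_basis, Module.Basis.constr_basis]
  simp

theorem bil_ext {f g : ABPoly →ₗ[ℤ] ABPoly →ₗ[ℤ] ABPoly}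
    (h : ∀ u v, f (abWord u) (abWord v) = g (abWord u) (abWord v)) : f = g := by
  refine (MonoidAlgebra.basis (FreeMonoid AB) ℤ).ext fun u => ?_
  refine (MonoidAlgebra.basis (FreeMonoid AB) ℤ).ext fun v => ?_
  rw [basis_apply, basis_apply]
  exact h _ _

theorem abWord_nil : abWord [] = 1 := by
  rw [abWord, FreeMonoid.ofList_nil, map_one]

theorem abWord_a (u : List AB) : abWord (AB.a :: u) = va * abWord u := by
  rw [abWord, FreeMonoid.ofList_cons, map_mul]; rfl

theorem abWord_b (u : List AB) : abWord (AB.b :: u) = vb * abWord u := by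
  rw [abWord, FreeMonoid.ofList_cons, map_mul]; rfl

theorem flagWord_nil_left (v : List AB) : flagWord [] v = abWord v := by
  rw [flagWord]

theorem flagWord_nil_right (u : List AB) : flagWord u [] = abWord u := by
  cases u <;> rw [flagWord]
  simp

theorem flagWord_a_left (u v : List AB) : flagWord (AB.a :: u) v = va * flagWord u v := by
  cases v with
  | nil => rw [flagWord_nil_right, flagWord_nil_right, abWord_a]
  | cons x v => rw [flagWord]; simp

theorem flagWord_a_right (u v : List AB) : flagWord u (AB.a :: v) = va * flagWord u v := by
  induction u with
  | nil => rw [flagWord_nil_left, flagWord_nil_left, abWord_a]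
  | cons x u ih =>
    cases x with
    | a => rw [flagWord_a_left, flagWord_a_left, ih]
    | b => rw [flagWord]

theorem flagDiamond_one_left (q : ABPoly) : flagDiamond 1 q = q := by
  have h : flagDiamond 1 = LinearMap.id := by
    refine (MonoidAlgebra.basis (FreeMonoid AB) ℤ).ext fun v => ?_
    rw [basis_apply, ← abWord_nil, flagDiamond_word, flagWord_nil_left]
    rfl
  rw [h]; rfl

theorem flagDiamond_one_right (p : ABPoly) : flagDiamond p 1 = p := by
  have h : flagDiamond.flip 1 = LinearMap.id := by
    refine (MonoidAlgebra.basis (FreeMonoid AB) ℤ).ext fun v => ?_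
    rw [basis_apply, ← abWord_nil, LinearMap.flip_apply, flagDiamond_word, flagWord_nil_right]
    rfl
  exact LinearMap.congr_fun h p

theorem flagDiamond_a_left (p q : ABPoly) :
    flagDiamond (va * p) q = va * flagDiamond p q := by
  have h : flagDiamond.comp (LinearMap.mulLeft ℤ va) =
      flagDiamond.compr₂ (LinearMap.mulLeft ℤ va) := by
    refine bil_ext fun u v => ?_
    simp only [LinearMap.comp_apply, LinearMap.compr₂_apply, LinearMap.mulLeft_apply]
    rw [← abWord_a, flagDiamond_word, flagDiamond_word, flagWord_a_left]
  exact LinearMap.congr_fun (LinearMap.congr_fun h p) q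

theorem flagDiamond_a_right (p q : ABPoly) :
    flagDiamond p (va * q) = va * flagDiamond p q := by
  have h : flagDiamond.compl₂ (LinearMap.mulLeft ℤ va) =
      flagDiamond.compr₂ (LinearMap.mulLeft ℤ va) := by
    refine bil_ext fun u v => ?_
    simp only [LinearMap.compl₂_apply, LinearMap.compr₂_apply, LinearMap.mulLeft_apply]
    rw [← abWord_a, flagDiamond_word, flagDiamond_word, flagWord_a_right]
  exact LinearMap.congr_fun (LinearMap.congr_fun h p) q

theorem flagDiamond_b (p q : ABPoly) :
    flagDiamond (vb * p) (vb * q) = vb * flagDiamond p (vb * q) + vb * flagDiamond (vb * p) q +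
      vb * va * flagDiamond p q := by
  have h : flagDiamond.compl₁₂ (LinearMap.mulLeft ℤ vb) (LinearMap.mulLeft ℤ vb) =
      (flagDiamond.compl₂ (LinearMap.mulLeft ℤ vb)).compr₂ (LinearMap.mulLeft ℤ vb) +
      (flagDiamond.comp (LinearMap.mulLeft ℤ vb)).compr₂ (LinearMap.mulLeft ℤ vb) +
      flagDiamond.compr₂ (LinearMap.mulLeft ℤ (vb * va)) := by
    refine bil_ext fun u v => ?_
    simp only [LinearMap.compl₂_apply, LinearMap.compr₂_apply, LinearMap.mulLeft_apply,
      LinearMap.compl₁₂_apply, LinearMap.add_apply, LinearMap.comp_apply]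
    rw [← abWord_b, ← abWord_b]
    simp only [flagDiamond_word]
    rw [flagWord]
  exact LinearMap.congr_fun (LinearMap.congr_fun h p) q

theorem flagDiamond_pow_left (i : ℕ) (p q : ABPoly) :
    flagDiamond (va ^ i * p) q = va ^ i * flagDiamond p q := by
  induction i with
  | zero => simp
  | succ i ih => rw [pow_succ', mul_assoc, flagDiamond_a_left, ih, mul_assoc]

theorem flagDiamond_pow_right (i : ℕ) (p q : ABPoly) :
    flagDiamond p (va ^ i * q) = va ^ i * flagDiamond p q := by
  induction i with
  | zero => simp
  | succ i ih => rw [pow_succ', mul_assoc, flagDiamond_a_right, ih, mul_assoc]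

theorem flagDiamond_gap (i j : ℕ) (p q : ABPoly) :
    flagDiamond (vb * va ^ i * p) (vb * va ^ j * q) =
      vb * va ^ i * flagDiamond p (vb * va ^ j * q) +
      vb * va ^ j * flagDiamond (vb * va ^ i * p) q +
      vb * va ^ (i + j + 1) * flagDiamond p q := by
  simp only [mul_assoc]
  rw [flagDiamond_b, flagDiamond_pow_left, flagDiamond_pow_right, flagDiamond_pow_right,
    flagDiamond_pow_left]
  have h : va ^ (i + j + 1) = va * (va ^ j * va ^ i) := by
    rw [← pow_add, ← pow_succ']; congr 1; omega
  rw [h]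
  simp only [mul_assoc]

theorem toFlag_ofFlag (p : ABPoly) : toFlag (ofFlag p) = p := by
  have h : toFlag.comp ofFlag = AlgHom.id ℤ ABPoly := by
    apply MonoidAlgebra.algHom_ext'
    on_goal 2 => exact Subsingleton.elim _ _
    refine FreeMonoid.hom_eq (M := ABPoly) fun x => ?_
    have ha : toFlag va = va + vb := by simp [toFlag, va]
    have hb : toFlag vb = vb := by simp [toFlag, vb]
    cases x
    · change toFlag (ofFlag va) = va
      have : ofFlag va = va - vb := by simp [ofFlag, va]
      rw [this, map_sub, ha, hb, add_sub_cancel_right]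
    · change toFlag (ofFlag vb) = vb
      have : ofFlag vb = vb := by simp [ofFlag, vb]
      rw [this, hb]
  exact AlgHom.congr_fun h p

theorem diamond_ofFlag (p q : ABPoly) :
    diamond (ofFlag p) (ofFlag q) = ofFlag (flagDiamond p q) := by
  simp [diamond, toFlag_ofFlag]

/-! ### The flag `f`-polynomial of a poset -/

theorem setWord_congr {l : List ℕ} {S T : Finset ℕ} (h : ∀ i ∈ l, i ∈ S ↔ i ∈ T) :
    setWord l S = setWord l T := by
  unfold setWord
  congr 1
  refine List.map_congr_left fun i hi => ?_
  simp [h i hi]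

theorem ofFlag_va : ofFlag va = va - vb := by
  simp [ofFlag, va]

theorem ofFlag_vb : ofFlag vb = vb := by
  simp [ofFlag, vb]

theorem setWord_cons (j : ℕ) (l : List ℕ) (S : Finset ℕ) :
    setWord (j :: l) S = (if j ∈ S then vb else va) * setWord l S := by
  simp [setWord]

theorem ofFlag_setWord (l : List ℕ) (hl : l.Nodup) (T : Finset ℕ) (hT : T ⊆ l.toFinset) :
    ofFlag (setWord l T) = ∑ S ∈ l.toFinset.powerset,
      if T ⊆ S then ((-1 : ℤ) ^ (S \ T).card) • setWord l S else 0 := by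
  induction l generalizing T with
  | nil =>
    have : T = ∅ := by simpa using hT
    simp [this, setWord]
  | cons j l ih =>
    obtain ⟨hj, hl⟩ := List.nodup_cons.1 hl
    have hj' : j ∉ l.toFinset := by simpa using hj
    rw [List.toFinset_cons, Finset.sum_powerset_insert hj', setWord_cons, map_mul]
    have hins : ∀ S : Finset ℕ, setWord l (insert j S) = setWord l S := fun S =>
      setWord_congr fun i hi => by
        have : i ≠ j := fun h => hj (h ▸ hi)
        simp [this]
    by_cases hjT : j ∈ T
    · have hT' : T.erase j ⊆ l.toFinset := by
        intro i hi
        have := hT (Finset.mem_of_mem_erase hi)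
        have hne := Finset.ne_of_mem_erase hi
        simpa [hne] using this
      have hW : setWord l T = setWord l (T.erase j) := by
        conv_lhs => rw [← Finset.insert_erase hjT]
        rw [hins]
      rw [if_pos hjT, ofFlag_vb, hW, ih hl _ hT', Finset.mul_sum]
      have h0 : ∀ S ∈ l.toFinset.powerset,
          (if T ⊆ S then ((-1 : ℤ) ^ (S \ T).card) • setWord (j :: l) S else 0) = 0 := by
        intro S hS
        rw [if_neg]
        intro h
        exact hj' (Finset.mem_powerset.1 hS (h hjT))
      rw [Finset.sum_eq_zero h0, zero_add]
      refine Finset.sum_congr rfl fun S hS => ?_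
      have hjS : j ∉ S := fun h => hj' (Finset.mem_powerset.1 hS h)
      have h1 : T ⊆ insert j S ↔ T.erase j ⊆ S := by
        rw [Finset.subset_insert_iff]
      have h2 : insert j S \ T = S \ T.erase j := by
        ext i
        simp only [Finset.mem_sdiff, Finset.mem_insert, Finset.mem_erase]
        by_cases hij : i = j
        · subst hij; simp [hjT, hjS]
        · simp [hij]
      simp only [h1, h2]
      split_ifs with h
      · rw [setWord_cons, if_pos (Finset.mem_insert_self _ _), hins, mul_smul_comm]
      · simp
    · have hT' : T ⊆ l.toFinset := by
        intro i hi
        have := hT hi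
        have hne : i ≠ j := fun h => hjT (h ▸ hi)
        simpa [hne] using this
      rw [if_neg hjT, ofFlag_va, ih hl _ hT', sub_mul, Finset.mul_sum, Finset.mul_sum,
        sub_eq_add_neg, ← Finset.sum_neg_distrib]
      congr 1
      · refine Finset.sum_congr rfl fun S hS => ?_
        have hjS : j ∉ S := fun h => hj' (Finset.mem_powerset.1 hS h)
        split_ifs with h
        · rw [setWord_cons, if_neg hjS, mul_smul_comm]
        · simp
      · refine Finset.sum_congr rfl fun S hS => ?_
        have hjS : j ∉ S := fun h => hj' (Finset.mem_powerset.1 hS h)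
        have h1 : T ⊆ insert j S ↔ T ⊆ S := by
          rw [Finset.subset_insert_iff, Finset.erase_eq_of_notMem hjT]
        have h2 : (insert j S \ T).card = (S \ T).card + 1 := by
          rw [Finset.insert_sdiff_of_notMem _ hjT, Finset.card_insert_of_notMem]
          simp [hjS]
        simp only [h1, h2]
        split_ifs with h
        · rw [setWord_cons, if_pos (Finset.mem_insert_self _ _), hins, mul_smul_comm, pow_succ]
          simp
        · simp

theorem abIndex_eq_ofFlag {P : Type*} [PartialOrder P] (ρ : P → ℕ) (n : ℕ) :
    abIndex ρ n = ofFlag (∑ T ∈ (Finset.Icc 1 n).powerset,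
      (flagF ρ T : ℤ) • setWord (List.range' 1 n) T) := by
  have hl : (List.range' 1 n).toFinset = Finset.Icc 1 n := by
    ext i; simp [List.mem_range'_1]; omega
  rw [map_sum]
  have h : ∀ T ∈ (Finset.Icc 1 n).powerset,
      ofFlag ((flagF ρ T : ℤ) • setWord (List.range' 1 n) T) =
      ∑ S ∈ (Finset.Icc 1 n).powerset,
        if T ⊆ S then ((-1 : ℤ) ^ (S \ T).card * flagF ρ T) • setWord (List.range' 1 n) S
        else 0 := by
    intro T hT
    rw [map_zsmul, ofFlag_setWord _ List.nodup_range' _ (by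
      rw [hl]; exact Finset.mem_powerset.1 hT), hl, Finset.smul_sum]
    refine Finset.sum_congr rfl fun S _ => ?_
    split_ifs
    · rw [smul_smul, mul_comm]
    · simp
  rw [Finset.sum_congr rfl h, Finset.sum_comm]
  refine Finset.sum_congr rfl fun S hS => ?_
  rw [flagH, Finset.sum_smul, ← Finset.sum_filter]
  refine Finset.sum_congr ?_ fun _ _ => rfl
  ext T
  simp only [Finset.mem_powerset, Finset.mem_filter] at hS ⊢
  exact ⟨fun h => ⟨h.trans hS, h⟩, fun h => h.2⟩

section ChainSums

open Classical

variable {P : Type*} [PartialOrder P] [Fintype P]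

/-- The chains strictly between `x` and `t`. -/
def chainsIn (t x : P) : Finset (Finset P) :=
  Finset.univ.filter fun C : Finset P =>
    IsChain (· ≤ ·) (C : Set P) ∧ ∀ y ∈ C, x < y ∧ y < t

theorem mem_chainsIn {t x : P} {C : Finset P} : C ∈ chainsIn t x ↔
    IsChain (· ≤ ·) (C : Set P) ∧ ∀ y ∈ C, x < y ∧ y < t := by
  simp [chainsIn]

/-- The sum of the words of the chains strictly between `x` and `t`. -/
def chainSum (ρ : P → ℕ) (n : ℕ) (t x : P) : ABPoly :=
  ∑ C ∈ chainsIn t x,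
    setWord (List.range' (ρ x + 1) (n - ρ x)) (Finset.image ρ C)

/-- The same sum, with the letter `b` of the element `x` itself. -/
def chainSum' (ρ : P → ℕ) (n : ℕ) (t x : P) : ABPoly :=
  if x = t then 1 else vb * chainSum ρ n t x

theorem setWord_append (l l' : List ℕ) (S : Finset ℕ) :
    setWord (l ++ l') S = setWord l S * setWord l' S := by
  simp [setWord]

theorem setWord_of_forall_notMem (l : List ℕ) (S : Finset ℕ) (h : ∀ i ∈ l, i ∉ S) :
    setWord l S = va ^ l.length := by
  induction l with
  | nil => simp [setWord]
  | cons j l ih =>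
    rw [setWord_cons, if_neg (h j (by simp)), ih fun i hi => h i (by simp [hi]), List.length_cons,
      pow_succ']

theorem setWord_split (n r s : ℕ) (hrs : r < s) (hsn : s ≤ n) (S : Finset ℕ)
    (hS : ∀ i ∈ S, s < i) :
    setWord (List.range' (r + 1) (n - r)) (insert s S) =
      va ^ (s - r - 1) * (vb * setWord (List.range' (s + 1) (n - s)) S) := by
  have hl : List.range' (r + 1) (n - r) =
      List.range' (r + 1) (s - r - 1) ++ s :: List.range' (s + 1) (n - s) := by
    have h1 : s :: List.range' (s + 1) (n - s) = List.range' s (n - s + 1) := by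
      rw [List.range'_succ]
    have h2 : s = r + 1 + 1 * (s - r - 1) := by omega
    have h3 : n - r = s - r - 1 + (n - s + 1) := by omega
    rw [h1, h3, ← List.range'_append, ← h2]
  rw [hl, setWord_append, setWord_cons, if_pos (Finset.mem_insert_self _ _),
    setWord_of_forall_notMem, List.length_range']
  · congr 2
    refine setWord_congr fun i hi => ?_
    have : i ≠ s := by
      have := (List.mem_range'_1.1 hi).1
      omega
    simp [this]
  · intro i hi hiS
    have h1 := List.mem_range'_1.1 hi
    rcases Finset.mem_insert.1 hiS with h | h
    · omega
    · have := hS i h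
      omega

theorem chainSum_rec (ρ : P → ℕ) (hρ : StrictMono ρ) (n : ℕ) (t : P) (ht : ∀ x, x ≤ t)
    (hn : ρ t = n + 1) (x : P) (hx : x ≠ t) :
    chainSum ρ n t x = ∑ y : P with x < y, va ^ (ρ y - ρ x - 1) * chainSum' ρ n t y := by
  have hxt : x < t := lt_of_le_of_ne (ht x) hx
  have hlt : ∀ y, y < t → ρ y ≤ n := fun y hy => by have := hρ hy; omega
  have hE : (∅ : Finset P) ∈ chainsIn t x := by
    simp [mem_chainsIn]
  have hT : t ∈ ({y : P | x < y} : Finset P) := by simpa using hxt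
  rw [chainSum, ← Finset.add_sum_erase _ _ hE, ← Finset.add_sum_erase _ _ hT]
  congr 1
  · rw [setWord_of_forall_notMem _ _ (by simp), List.length_range', chainSum', if_pos rfl, hn]
    rw [mul_one]
    congr 1
    omega
  · have hR : ∀ y ∈ ({y : P | x < y} : Finset P).erase t,
        va ^ (ρ y - ρ x - 1) * chainSum' ρ n t y =
        ∑ C ∈ chainsIn t y,
          setWord (List.range' (ρ x + 1) (n - ρ x)) ((insert y C).image ρ) := by
      intro y hy
      have hyt := Finset.ne_of_mem_erase hy
      have hxy : x < y := by simpa using Finset.mem_of_mem_erase hy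
      rw [chainSum', if_neg hyt, chainSum, Finset.mul_sum, Finset.mul_sum]
      refine Finset.sum_congr rfl fun C hC => ?_
      rw [Finset.image_insert, setWord_split n (ρ x) (ρ y) (hρ hxy)
        (hlt y (lt_of_le_of_ne (ht y) hyt))]
      intro i hi
      obtain ⟨z, hz, rfl⟩ := Finset.mem_image.1 hi
      exact hρ ((mem_chainsIn.1 hC).2 z hz).1
    rw [Finset.sum_congr rfl hR, Finset.sum_sigma']
    symm
    refine Finset.sum_bij (fun p _ => insert p.1 p.2) ?_ ?_ ?_ ?_
    · rintro ⟨y, C⟩ h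
      simp only [Finset.mem_sigma, Finset.mem_erase, mem_chainsIn, Finset.mem_filter, Finset.mem_univ,
        true_and] at h ⊢
      obtain ⟨⟨hyt, hxy⟩, hC, hCy⟩ := h
      refine ⟨Finset.insert_ne_empty _ _, ?_, ?_⟩
      · rw [Finset.coe_insert]
        exact hC.insert fun z hz _ => Or.inl (hCy z hz).1.le
      · intro z hz
        rcases Finset.mem_insert.1 hz with rfl | hz
        · exact ⟨hxy, lt_of_le_of_ne (ht _) hyt⟩
        · exact ⟨hxy.trans (hCy z hz).1, (hCy z hz).2⟩
    · rintro ⟨y, C⟩ h ⟨y', C'⟩ h' hEq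
      simp only [Finset.mem_sigma, Finset.mem_erase, mem_chainsIn, Finset.mem_filter, Finset.mem_univ,
        true_and] at h h'
      obtain ⟨_, _, hCy⟩ := h
      obtain ⟨_, _, hCy'⟩ := h'
      have hEq : insert y C = insert y' C' := hEq
      have hyC : y ∉ C := fun h => lt_irrefl _ (hCy y h).1
      have hyC' : y' ∉ C' := fun h => lt_irrefl _ (hCy' y' h).1
      have hyy : y = y' := by
        have h1 : y ∈ insert y' C' := hEq ▸ Finset.mem_insert_self y C
        have h2 : y' ∈ insert y C := hEq ▸ Finset.mem_insert_self y' C'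
        rcases Finset.mem_insert.1 h1 with h1 | h1
        · exact h1
        · rcases Finset.mem_insert.1 h2 with h2 | h2
          · exact h2.symm
          · exact absurd ((hCy _ h2).1.trans (hCy' _ h1).1) (lt_irrefl _)
      subst hyy
      have hCC : C = C' := by
        rw [← Finset.erase_insert hyC, hEq, Finset.erase_insert hyC']
      rw [hCC]
    · intro C hC
      simp only [Finset.mem_erase, mem_chainsIn] at hC
      obtain ⟨hne, hch, hCx⟩ := hC
      obtain ⟨y, hy, hmin⟩ := Finset.exists_min_image C ρ (Finset.nonempty_iff_ne_empty.2 hne)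
      refine ⟨⟨y, C.erase y⟩, ?_, Finset.insert_erase hy⟩
      simp only [Finset.mem_sigma, Finset.mem_erase, mem_chainsIn, Finset.mem_filter, Finset.mem_univ,
        true_and]
      refine ⟨⟨(hCx y hy).2.ne, (hCx y hy).1⟩, ?_, ?_⟩
      · exact hch.mono (by simp)
      · rintro z ⟨hzy, hz⟩
        refine ⟨?_, (hCx z hz).2⟩
        rcases hch.total hy hz with h | h
        · exact lt_of_le_of_ne h hzy.symm
        · have h1 := hρ (lt_of_le_of_ne h hzy)
          have h2 := hmin z hz
          omega
    · rintro ⟨y, C⟩ _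
      rfl

theorem chainSum'_rec (ρ : P → ℕ) (hρ : StrictMono ρ) (n : ℕ) (t : P) (ht : ∀ x, x ≤ t)
    (hn : ρ t = n + 1) (x : P) (hx : x ≠ t) :
    chainSum' ρ n t x = ∑ y : P with x < y, vb * va ^ (ρ y - ρ x - 1) * chainSum' ρ n t y := by
  rw [chainSum', if_neg hx, chainSum_rec ρ hρ n t ht hn x hx, Finset.mul_sum]
  simp only [mul_assoc]

theorem abIndex_eq_chainSum (ρ : P → ℕ) (hρ : StrictMono ρ) (n : ℕ) (t : P) (ht : ∀ x, x ≤ t)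
    (hn : ρ t = n + 1) (o : P) (ho : ∀ x, o ≤ x) (h0 : ρ o = 0) :
    abIndex ρ n = ofFlag (chainSum ρ n t o) := by
  rw [abIndex_eq_ofFlag, chainSum]
  congr 1
  have hmem : ∀ y, (o < y ∧ y < t) ↔ ρ y ∈ Finset.Icc 1 n := by
    intro y
    rw [Finset.mem_Icc]
    constructor
    · rintro ⟨h1, h2⟩
      have := hρ h1
      have := hρ h2
      omega
    · rintro ⟨h1, h2⟩
      refine ⟨lt_of_le_of_ne (ho y) ?_, lt_of_le_of_ne (ht y) ?_⟩
      · rintro rfl; omega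
      · rintro rfl; omega
  have hmaps : ∀ C ∈ chainsIn t o,
      C.image ρ ∈ (Finset.Icc 1 n).powerset := by
    intro C hC
    rw [Finset.mem_powerset]
    intro i hi
    obtain ⟨y, hy, rfl⟩ := Finset.mem_image.1 hi
    exact (hmem y).1 ((mem_chainsIn.1 hC).2 y hy)
  rw [← Finset.sum_fiberwise_of_maps_to hmaps]
  refine Finset.sum_congr rfl fun T hT => ?_
  rw [h0, Nat.sub_zero, Nat.zero_add]
  have hs : ∀ C ∈ (chainsIn t o).filter fun C => C.image ρ = T,
      setWord (List.range' 1 n) (C.image ρ) = setWord (List.range' 1 n) T := by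
    intro C hC
    rw [(Finset.mem_filter.1 hC).2]
  rw [Finset.sum_congr rfl hs, Finset.sum_const, natCast_zsmul]
  congr 1
  rw [flagF, ← Set.ncard_coe_finset]
  congr 1
  ext C
  simp only [Set.mem_ofPred_eq, Finset.coe_filter, mem_chainsIn]
  constructor
  · rintro ⟨h1, h2⟩
    refine ⟨⟨h1, fun y hy => (hmem y).2 ?_⟩, h2⟩
    exact Finset.mem_powerset.1 hT (h2 ▸ Finset.mem_image_of_mem ρ hy)
  · rintro ⟨⟨h1, _⟩, h2⟩
    exact ⟨h1, h2⟩

end ChainSums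

section Products

open Classical

theorem sum_lt_withBot {Z : Type*} [PartialOrder Z] [Fintype Z]
    [Fintype (WithBot Z)] (z : Z) {_ : DecidablePred fun w : WithBot Z => (z : WithBot Z) < w}
    (g : WithBot Z → ABPoly) :
    ∑ w : WithBot Z with (z : WithBot Z) < w, g w = ∑ w : Z with z < w, g w := by
  symm
  refine Finset.sum_bij (fun w _ => (w : WithBot Z)) ?_ ?_ ?_ ?_
  · intro w hw
    simpa using hw
  · intro w _ w' _ h
    exact WithBot.coe_injective h
  · intro w hw
    have hw : (z : WithBot Z) < w := by simpa using hw
    induction w using WithBot.recBotCoe with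
    | bot => simp at hw
    | coe w => exact ⟨w, by simpa using hw, rfl⟩
  · intro w _
    rfl

theorem sum_bot_lt_withBot {Z : Type*} [PartialOrder Z] [Fintype Z]
    [Fintype (WithBot Z)] {_ : DecidablePred fun w : WithBot Z => ⊥ < w} (g : WithBot Z → ABPoly) :
    ∑ w : WithBot Z with ⊥ < w, g w = ∑ w : Z, g w := by
  symm
  refine Finset.sum_bij (fun w _ => (w : WithBot Z)) ?_ ?_ ?_ ?_
  · intro w hw
    simp
  · intro w _ w' _ h
    exact WithBot.coe_injective h
  · intro w hw
    have hw : ⊥ < w := by simpa using hw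
    induction w using WithBot.recBotCoe with
    | bot => simp at hw
    | coe w => exact ⟨w, by simp, rfl⟩
  · intro w _
    rfl

theorem sum_lt_subtype {P : Type*} [PartialOrder P] [OrderBot P] [Fintype P]
    (x : {x : P // x ≠ ⊥}) (g : P → ABPoly) :
    ∑ y : P with x.1 < y, g y = ∑ y : {x : P // x ≠ ⊥} with x < y, g y := by
  symm
  refine Finset.sum_bij (fun w _ => w.1) ?_ ?_ ?_ ?_
  · intro w hw
    simpa using hw
  · intro w _ w' _ h
    exact Subtype.ext h
  · intro w hw
    have hw : x.1 < w := by simpa using hw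
    exact ⟨⟨w, (bot_le.trans_lt hw).ne'⟩, by simpa [← Subtype.coe_lt_coe] using hw, rfl⟩
  · intro w _
    rfl

theorem sum_bot_lt_subtype {P : Type*} [PartialOrder P] [OrderBot P] [Fintype P]
    (g : P → ABPoly) :
    ∑ y : P with ⊥ < y, g y = ∑ y : {x : P // x ≠ ⊥}, g y := by
  symm
  refine Finset.sum_bij (fun w _ => w.1) ?_ ?_ ?_ ?_
  · intro w hw
    simpa [bot_lt_iff_ne_bot] using w.2
  · intro w _ w' _ h
    exact Subtype.ext h
  · intro w hw
    have hw : ⊥ < w := by simpa using hw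
    exact ⟨⟨w, hw.ne'⟩, by simp, rfl⟩
  · intro w _
    rfl

theorem sum_lt_prod {X Y : Type*} [PartialOrder X] [Fintype X] [PartialOrder Y] [Fintype Y]
    (x : X) (y : Y) (g : X × Y → ABPoly) :
    ∑ w : X × Y with (x, y) < w, g w =
      ∑ x' : X with x < x', g (x', y) + ∑ y' : Y with y < y', g (x, y') +
      ∑ x' : X with x < x', ∑ y' : Y with y < y', g (x', y') := by
  have h1 : ({w : X × Y | (x, y) < w} : Finset (X × Y)) =
      ((({x' : X | x < x'} : Finset X) ×ˢ {y}) ∪ ({x} ×ˢ ({y' : Y | y < y'} : Finset Y))) ∪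
        (({x' : X | x < x'} : Finset X) ×ˢ ({y' : Y | y < y'} : Finset Y)) := by
    ext ⟨x', y'⟩
    simp only [Finset.mem_filter, Finset.mem_univ, true_and, Finset.mem_union,
      Finset.mem_product, Finset.mem_singleton, Prod.mk_lt_mk]
    constructor
    · rintro (⟨h, h'⟩ | ⟨h, h'⟩)
      · rcases h'.lt_or_eq with h' | rfl
        · exact Or.inr ⟨h, h'⟩
        · exact Or.inl (Or.inl ⟨h, rfl⟩)
      · rcases h.lt_or_eq with h | rfl
        · exact Or.inr ⟨h, h'⟩
        · exact Or.inl (Or.inr ⟨rfl, h'⟩)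
    · rintro ((⟨h, rfl⟩ | ⟨rfl, h⟩) | ⟨h, h'⟩)
      · exact Or.inl ⟨h, le_rfl⟩
      · exact Or.inr ⟨le_rfl, h⟩
      · exact Or.inl ⟨h, h'.le⟩
  rw [h1, Finset.sum_union, Finset.sum_union, Finset.sum_product, Finset.sum_product,
    Finset.sum_product]
  · simp
  · rw [Finset.disjoint_left]
    rintro ⟨x', y'⟩ h h'
    simp only [Finset.mem_product, Finset.mem_filter, Finset.mem_singleton] at h h'
    obtain ⟨⟨_, h⟩, _⟩ := h
    exact absurd (h'.1 ▸ h) (lt_irrefl _)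
  · rw [Finset.disjoint_left]
    rintro ⟨x', y'⟩ h h'
    simp only [Finset.mem_union, Finset.mem_product, Finset.mem_filter, Finset.mem_singleton,
      Finset.mem_univ, true_and] at h h'
    rcases h with h | h
    · exact absurd (h.2 ▸ h'.2) (lt_irrefl _)
    · exact absurd (h.1 ▸ h'.1) (lt_irrefl _)

end Products

section Main

open Classical

variable {P Q : Type*} [PartialOrder P] [BoundedOrder P] [Fintype P]
  [PartialOrder Q] [BoundedOrder Q] [Fintype Q]

set_option linter.unusedSectionVars false in
theorem diamondRank_strictMono {ρ : P → ℕ} (hρ : StrictMono ρ) {σ : Q → ℕ} (hσ : StrictMono σ) :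
    StrictMono (diamondRank ρ σ) := by
  have hp : ∀ x : P, x ≠ ⊥ → 0 < ρ x := fun x hx =>
    (Nat.zero_le _).trans_lt (hρ (bot_lt_iff_ne_bot.2 hx))
  have hq : ∀ x : Q, x ≠ ⊥ → 0 < σ x := fun x hx =>
    (Nat.zero_le _).trans_lt (hσ (bot_lt_iff_ne_bot.2 hx))
  intro w w' h
  induction w' using WithBot.recBotCoe with
  | bot => simp at h
  | coe z' =>
    have h1 := hp _ z'.1.2
    have h2 := hq _ z'.2.2
    induction w using WithBot.recBotCoe with
    | bot =>
      change 0 < ρ z'.1 + σ z'.2 - 1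
      omega
    | coe z =>
      change ρ z.1 + σ z.2 - 1 < ρ z'.1 + σ z'.2 - 1
      have h : z < z' := WithBot.coe_lt_coe.1 h
      rcases Prod.lt_iff.1 h with ⟨h3, h4⟩ | ⟨h3, h4⟩
      · have h5 : ρ z.1 < ρ z'.1 := hρ h3
        have h6 : σ z.2 ≤ σ z'.2 := hσ.monotone h4
        omega
      · have h5 : ρ z.1 ≤ ρ z'.1 := hρ.monotone h3
        have h6 : σ z.2 < σ z'.2 := hσ h4
        omega

theorem chainSum'_diamond (ρ : P → ℕ) (hρ : StrictMono ρ) (n : ℕ) (hn : ρ ⊤ = n + 1)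
    (σ : Q → ℕ) (hσ : StrictMono σ) (m : ℕ) (hm : σ ⊤ = m + 1)
    (hP : (⊤ : P) ≠ ⊥) (hQ : (⊤ : Q) ≠ ⊥) (z : {x : P // x ≠ ⊥} × {y : Q // y ≠ ⊥}) :
    chainSum' (P := DiamondPoset P Q) (diamondRank ρ σ) (n + m)
        ((⟨⊤, hP⟩, ⟨⊤, hQ⟩) : {x : P // x ≠ ⊥} × {y : Q // y ≠ ⊥}) z =
      flagDiamond (chainSum' ρ n ⊤ z.1.1) (chainSum' σ m ⊤ z.2.1) := by
  have hp : ∀ x : P, x ≠ ⊥ → 0 < ρ x := fun x hx =>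
    (Nat.zero_le _).trans_lt (hρ (bot_lt_iff_ne_bot.2 hx))
  have hq : ∀ x : Q, x ≠ ⊥ → 0 < σ x := fun x hx =>
    (Nat.zero_le _).trans_lt (hσ (bot_lt_iff_ne_bot.2 hx))
  have htop : ∀ w : DiamondPoset P Q,
      w ≤ ((⟨⊤, hP⟩, ⟨⊤, hQ⟩) : {x : P // x ≠ ⊥} × {y : Q // y ≠ ⊥}) := by
    intro w
    induction w using WithBot.recBotCoe with
    | bot => exact bot_le
    | coe w => exact WithBot.coe_le_coe.2 ⟨le_top (a := w.1.1), le_top (a := w.2.1)⟩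
  have hrank : diamondRank ρ σ (((⟨⊤, hP⟩, ⟨⊤, hQ⟩) :
      {x : P // x ≠ ⊥} × {y : Q // y ≠ ⊥}) : DiamondPoset P Q) = n + m + 1 := by
    change ρ ⊤ + σ ⊤ - 1 = n + m + 1
    omega
  have hrec := chainSum'_rec (P := DiamondPoset P Q) (diamondRank ρ σ)
    (diamondRank_strictMono hρ hσ) (n + m) _ htop hrank
  have hrecP := chainSum'_rec ρ hρ n ⊤ (fun _ => le_top) hn
  have hrecQ := chainSum'_rec σ hσ m ⊤ (fun _ => le_top) hm
  have hd : ∀ z : {x : P // x ≠ ⊥} × {y : Q // y ≠ ⊥},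
      diamondRank ρ σ (z : DiamondPoset P Q) = ρ z.1 + σ z.2 - 1 := fun _ => rfl
  induction z using WellFoundedGT.induction with
  | ind z ih =>
  obtain ⟨x, y⟩ := z
  by_cases hz : ((x, y) : {x : P // x ≠ ⊥} × {y : Q // y ≠ ⊥}) = (⟨⊤, hP⟩, ⟨⊤, hQ⟩)
  · have hx : x = ⟨⊤, hP⟩ := congrArg Prod.fst hz
    have hy : y = ⟨⊤, hQ⟩ := congrArg Prod.snd hz
    subst hx hy
    simp only [chainSum', if_true]
    exact (flagDiamond_one_left 1).symm
  rw [hrec _ (fun h => hz (WithBot.coe_injective h)), sum_lt_withBot, sum_lt_prod]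
  have e1 : ∀ x' ∈ ({x' | x < x'} : Finset {x : P // x ≠ ⊥}),
      vb * va ^ (diamondRank ρ σ (((x', y) : {x : P // x ≠ ⊥} × {y : Q // y ≠ ⊥}) :
        DiamondPoset P Q) - diamondRank ρ σ (((x, y) : {x : P // x ≠ ⊥} × {y : Q // y ≠ ⊥}) :
        DiamondPoset P Q) - 1) * chainSum' (P := DiamondPoset P Q) (diamondRank ρ σ) (n + m)
        ((⟨⊤, hP⟩, ⟨⊤, hQ⟩) : {x : P // x ≠ ⊥} × {y : Q // y ≠ ⊥})
        ((x', y) : {x : P // x ≠ ⊥} × {y : Q // y ≠ ⊥}) =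
      vb * va ^ (ρ x' - ρ x - 1) * flagDiamond (chainSum' ρ n ⊤ x'.1) (chainSum' σ m ⊤ y.1) := by
    intro x' hx'
    have hx' : x < x' := by simpa using hx'
    rw [ih (x', y) (Prod.mk_lt_mk.2 (Or.inl ⟨hx', le_rfl⟩)), hd, hd]
    have := hq _ y.2
    congr 3
    simp only
    omega
  have e2 : ∀ y' ∈ ({y' | y < y'} : Finset {y : Q // y ≠ ⊥}),
      vb * va ^ (diamondRank ρ σ (((x, y') : {x : P // x ≠ ⊥} × {y : Q // y ≠ ⊥}) :
        DiamondPoset P Q) - diamondRank ρ σ (((x, y) : {x : P // x ≠ ⊥} × {y : Q // y ≠ ⊥}) :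
        DiamondPoset P Q) - 1) * chainSum' (P := DiamondPoset P Q) (diamondRank ρ σ) (n + m)
        ((⟨⊤, hP⟩, ⟨⊤, hQ⟩) : {x : P // x ≠ ⊥} × {y : Q // y ≠ ⊥})
        ((x, y') : {x : P // x ≠ ⊥} × {y : Q // y ≠ ⊥}) =
      vb * va ^ (σ y' - σ y - 1) * flagDiamond (chainSum' ρ n ⊤ x.1) (chainSum' σ m ⊤ y'.1) := by
    intro y' hy'
    have hy' : y < y' := by simpa using hy'
    rw [ih (x, y') (Prod.mk_lt_mk.2 (Or.inr ⟨le_rfl, hy'⟩)), hd, hd]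
    have := hp _ x.2
    congr 3
    simp only
    omega
  have e3 : ∀ x' ∈ ({x' | x < x'} : Finset {x : P // x ≠ ⊥}),
      ∑ y' : {y : Q // y ≠ ⊥} with y < y',
      vb * va ^ (diamondRank ρ σ (((x', y') : {x : P // x ≠ ⊥} × {y : Q // y ≠ ⊥}) :
        DiamondPoset P Q) - diamondRank ρ σ (((x, y) : {x : P // x ≠ ⊥} × {y : Q // y ≠ ⊥}) :
        DiamondPoset P Q) - 1) * chainSum' (P := DiamondPoset P Q) (diamondRank ρ σ) (n + m)
        ((⟨⊤, hP⟩, ⟨⊤, hQ⟩) : {x : P // x ≠ ⊥} × {y : Q // y ≠ ⊥})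
        ((x', y') : {x : P // x ≠ ⊥} × {y : Q // y ≠ ⊥}) =
      ∑ y' : {y : Q // y ≠ ⊥} with y < y',
      vb * va ^ ((ρ x' - ρ x - 1) + (σ y' - σ y - 1) + 1) *
        flagDiamond (chainSum' ρ n ⊤ x'.1) (chainSum' σ m ⊤ y'.1) := by
    intro x' hx'
    have hx' : x < x' := by simpa using hx'
    refine Finset.sum_congr rfl fun y' hy' => ?_
    have hy' : y < y' := by simpa using hy'
    rw [ih (x', y') (Prod.mk_lt_mk.2 (Or.inl ⟨hx', hy'.le⟩)), hd, hd]
    have := hp _ x.2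
    have := hq _ y.2
    have h1 : ρ x < ρ x' := hρ hx'
    have h2 : σ y < σ y' := hσ hy'
    congr 3
    simp only
    omega
  rw [Finset.sum_congr rfl e1, Finset.sum_congr rfl e2, Finset.sum_congr rfl e3]
  simp only
  by_cases hx : x.1 = ⊤
  · have hy : y.1 ≠ ⊤ := fun hy => hz (Prod.ext (Subtype.ext hx) (Subtype.ext hy))
    have hE : ({x' | x < x'} : Finset {x : P // x ≠ ⊥}) = ∅ := by
      ext x'
      simp only [Finset.mem_filter, Finset.mem_univ, true_and, Finset.notMem_empty, iff_false]
      intro h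
      exact not_top_lt (a := x'.1) (hx ▸ h)
    have h1 : chainSum' ρ n ⊤ x.1 = 1 := by rw [chainSum', if_pos hx]
    rw [hE, h1]
    simp only [Finset.sum_empty, zero_add, add_zero, flagDiamond_one_left]
    rw [hrecQ _ hy, sum_lt_subtype]
  by_cases hy : y.1 = ⊤
  · have hE : ({y' | y < y'} : Finset {y : Q // y ≠ ⊥}) = ∅ := by
      ext y'
      simp only [Finset.mem_filter, Finset.mem_univ, true_and, Finset.notMem_empty, iff_false]
      intro h
      exact not_top_lt (a := y'.1) (hy ▸ h)
    have h1 : chainSum' σ m ⊤ y.1 = 1 := by rw [chainSum', if_pos hy]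
    rw [hE, h1]
    simp only [Finset.sum_empty, Finset.sum_const_zero, add_zero, flagDiamond_one_right]
    rw [hrecP _ hx, sum_lt_subtype]
  have hPx : chainSum' ρ n ⊤ x.1 = ∑ x' : {x : P // x ≠ ⊥} with x < x',
      vb * va ^ (ρ x' - ρ x - 1) * chainSum' ρ n ⊤ x'.1 := by
    rw [hrecP _ hx, sum_lt_subtype]
  have hQy : chainSum' σ m ⊤ y.1 = ∑ y' : {y : Q // y ≠ ⊥} with y < y',
      vb * va ^ (σ y' - σ y - 1) * chainSum' σ m ⊤ y'.1 := by
    rw [hrecQ _ hy, sum_lt_subtype]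
  have hR : flagDiamond (chainSum' ρ n ⊤ x.1) (chainSum' σ m ⊤ y.1) =
      ∑ x' : {x : P // x ≠ ⊥} with x < x', ∑ y' : {y : Q // y ≠ ⊥} with y < y',
        flagDiamond (vb * va ^ (ρ x' - ρ x - 1) * chainSum' ρ n ⊤ x'.1)
          (vb * va ^ (σ y' - σ y - 1) * chainSum' σ m ⊤ y'.1) := by
    rw [hPx, hQy, LinearMap.map_sum₂]
    refine Finset.sum_congr rfl fun x' _ => ?_
    rw [map_sum]
  rw [hR]
  simp only [flagDiamond_gap, Finset.sum_add_distrib]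
  congr 2
  · refine Finset.sum_congr rfl fun x' _ => ?_
    rw [← Finset.mul_sum, ← map_sum, ← hQy]
  · rw [Finset.sum_comm]
    refine Finset.sum_congr rfl fun y' _ => ?_
    rw [← Finset.mul_sum, ← LinearMap.map_sum₂, ← hPx]

end Main

/-- `Ψ(P ⋄ Q) = Ψ(P) ⋄ Ψ(Q)` for finite bounded posets `P` and `Q` with rank functions. -/
theorem abIndex_diamondPoset {P Q : Type*} [PartialOrder P] [BoundedOrder P] [Finite P]
    [PartialOrder Q] [BoundedOrder Q] [Finite Q]
    (ρ : P → ℕ) (hρ : StrictMono ρ) (hρ0 : ρ ⊥ = 0) (n : ℕ) (hn : ρ ⊤ = n + 1)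
    (σ : Q → ℕ) (hσ : StrictMono σ) (hσ0 : σ ⊥ = 0) (m : ℕ) (hm : σ ⊤ = m + 1) :
    abIndex (diamondRank ρ σ) (n + m) = diamond (abIndex ρ n) (abIndex σ m) := by
  classical
  have := Fintype.ofFinite P
  have := Fintype.ofFinite Q
  have hP : (⊤ : P) ≠ ⊥ := fun h => by rw [h] at hn; omega
  have hQ : (⊤ : Q) ≠ ⊥ := fun h => by rw [h] at hm; omega
  have hp : ∀ x : P, x ≠ ⊥ → 0 < ρ x := fun x hx =>
    (Nat.zero_le _).trans_lt (hρ (bot_lt_iff_ne_bot.2 hx))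
  have hq : ∀ x : Q, x ≠ ⊥ → 0 < σ x := fun x hx =>
    (Nat.zero_le _).trans_lt (hσ (bot_lt_iff_ne_bot.2 hx))
  have htop : ∀ w : DiamondPoset P Q,
      w ≤ ((⟨⊤, hP⟩, ⟨⊤, hQ⟩) : {x : P // x ≠ ⊥} × {y : Q // y ≠ ⊥}) := by
    intro w
    induction w using WithBot.recBotCoe with
    | bot => exact bot_le
    | coe w => exact WithBot.coe_le_coe.2 ⟨le_top (a := w.1.1), le_top (a := w.2.1)⟩
  have hrank : diamondRank ρ σ (((⟨⊤, hP⟩, ⟨⊤, hQ⟩) :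
      {x : P // x ≠ ⊥} × {y : Q // y ≠ ⊥}) : DiamondPoset P Q) = n + m + 1 := by
    change ρ ⊤ + σ ⊤ - 1 = n + m + 1
    omega
  have h0 : diamondRank ρ σ ⊥ = 0 := rfl
  rw [abIndex_eq_chainSum ρ hρ n ⊤ (fun _ => le_top) hn ⊥ (fun _ => bot_le) hρ0,
    abIndex_eq_chainSum σ hσ m ⊤ (fun _ => le_top) hm ⊥ (fun _ => bot_le) hσ0, diamond_ofFlag,
    abIndex_eq_chainSum (P := DiamondPoset P Q) _ (diamondRank_strictMono hρ hσ) (n + m) _ htop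
      hrank ⊥ (fun _ => bot_le) h0]
  congr 1
  rw [chainSum_rec (P := DiamondPoset P Q) _ (diamondRank_strictMono hρ hσ) (n + m) _ htop
      hrank ⊥ (by exact WithBot.bot_ne_coe),
    chainSum_rec ρ hρ n ⊤ (fun _ => le_top) hn ⊥ hP.symm,
    chainSum_rec σ hσ m ⊤ (fun _ => le_top) hm ⊥ hQ.symm,
    sum_bot_lt_withBot, sum_bot_lt_subtype, sum_bot_lt_subtype, Fintype.sum_prod_type,
    LinearMap.map_sum₂]
  refine Finset.sum_congr rfl fun x _ => ?_
  rw [map_sum]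
  refine Finset.sum_congr rfl fun y _ => ?_
  rw [flagDiamond_pow_left, flagDiamond_pow_right, ← mul_assoc, ← pow_add,
    chainSum'_diamond ρ hρ n hn σ hσ m hm hP hQ, h0, hρ0, hσ0]
  have h1 := hp _ x.2
  have h2 := hq _ y.2
  congr 2
  change ρ x + σ y - 1 - 0 - 1 = _
  omega

end CDDiamond

end

/-!
Both sides satisfy the same recursion in the first letters of `u` and `v`.

On the side of the diamond product, the substitution which turns the `ab`-index into the flag
`f`-polynomial turns `a - b` and `b` into the letters of `flagDiamond`. Hence `a - b` can be taken
out of each factor of `p ⋄ q`, and `b p ⋄ b q` has a three-term expansion (`diamond_b`). Put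
`H p q = b p ⋄ q - b (p ⋄ q)` (`defectLeft`) and `J p q = p ⋄ b q - b (p ⋄ q)` (`defectRight`).
These bilinear operators vanish if `q = 1` or `p = 1` respectively, and with `X = p ⋄ q`

* `H p (c q) = c H + d X` and `H p (d q) = d (H + J + c X)`, symmetrically for `J`,
* `c p ⋄ q = c X + 2 H` and `p ⋄ c q = c X + 2 J`,
* `d p ⋄ d q = d (p ⋄ d q) + d (d p ⋄ q) + (c d + d c) (H + J + c X)`,

where `H`, `J` without arguments are taken at `p`, `q`.

On the side of the paths, the four rules and the weights only involve a step, the labels at its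
starting point and the step after it. This is clear except for the fourth rule. A path can reach the
middle of a `d` of the vertical axis from below only by a `D` step, so that the fourth rule forbids
a `D R` above a `d` of the horizontal axis whenever `D` runs through the top half of a vertical `d`
(`isLabeledPath_iff`). The sum of the weights of the paths from a given point on, with prescribed
coefficients for the possible first steps (`pathSum`), is therefore computed by splitting off the
first step (`pathSum_eq`). The points of the grid are of four kinds, according to which of the
coordinates lie in the middle of a `d`. If `u` and `v` are the monomials in front of the point, then
the sum of all path weights is

* `u ⋄ v` if no coordinate is in the middle of a `d`,
* `c (u ⋄ v) + H u v` if the horizontal one is, the first term for the paths that start with `R`,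
* `c (u ⋄ v) + J u v` if the vertical one is,
* `c (c (u ⋄ v) + J u v) + c H u v + d (u ⋄ v)` if both are, for the paths that start with `R`, `U`
  and `D`.

These formulas, refined by the type of the first step where the preceding step may depend on it,
follow by a simultaneous induction on `u` and `v` (`pathSumFormulas`).
-/

noncomputable section

namespace CDDiamond

/-! ### The diamond product of polynomials in `c` and `d` -/

theorem ofFlag_toFlag (p : ABPoly) : ofFlag (toFlag p) = p := by
  have h : ofFlag.comp toFlag = AlgHom.id ℤ ABPoly := by
    apply MonoidAlgebra.algHom_ext'
    on_goal 2 => exact Subsingleton.elim _ _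
    refine FreeMonoid.hom_eq (M := ABPoly) fun x => ?_
    have ha : toFlag va = va + vb := by simp [toFlag, va]
    have hb : toFlag vb = vb := by simp [toFlag, vb]
    cases x
    · change ofFlag (toFlag va) = va
      rw [ha, map_add, ofFlag_va, ofFlag_vb, sub_add_cancel]
    · change ofFlag (toFlag vb) = vb
      rw [hb, ofFlag_vb]
  exact AlgHom.congr_fun h p

theorem diamond_toFlag (p q : ABPoly) :
    diamond p q = ofFlag (flagDiamond (toFlag p) (toFlag q)) := rfl

theorem toFlag_vb : toFlag vb = vb := by
  rw [← ofFlag_vb, toFlag_ofFlag, ofFlag_vb]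

theorem toFlag_va_sub_vb : toFlag (va - vb) = va := by
  rw [← ofFlag_va, toFlag_ofFlag]

theorem diamond_one_left (q : ABPoly) : diamond 1 q = q := by
  rw [diamond_toFlag, map_one, flagDiamond_one_left, ofFlag_toFlag]

theorem diamond_one_right (p : ABPoly) : diamond p 1 = p := by
  rw [diamond_toFlag, map_one, flagDiamond_one_right, ofFlag_toFlag]

theorem diamond_a_left (p q : ABPoly) :
    diamond (va * p) q = (va - vb) * diamond p q + diamond (vb * p) q := by
  have h : diamond ((va - vb) * p) q = (va - vb) * diamond p q := by
    rw [diamond_toFlag, map_mul, toFlag_va_sub_vb, flagDiamond_a_left, map_mul, ofFlag_va,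
      diamond_toFlag]
  rw [← h, ← LinearMap.add_apply, ← map_add, ← add_mul, sub_add_cancel]

theorem diamond_a_right (p q : ABPoly) :
    diamond p (va * q) = (va - vb) * diamond p q + diamond p (vb * q) := by
  have h : diamond p ((va - vb) * q) = (va - vb) * diamond p q := by
    rw [diamond_toFlag, map_mul, toFlag_va_sub_vb, flagDiamond_a_right, map_mul, ofFlag_va,
      diamond_toFlag]
  rw [← h, ← map_add, ← add_mul, sub_add_cancel]

theorem diamond_b (p q : ABPoly) :
    diamond (vb * p) (vb * q) = vb * diamond p (vb * q) + vb * diamond (vb * p) q +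
      vb * (va - vb) * diamond p q := by
  simp only [diamond_toFlag, map_mul, toFlag_vb, flagDiamond_b, map_add, ofFlag_vb, ofFlag_va]

/-- The defect of the left factor `b` in a diamond product: `b p ⋄ q - b (p ⋄ q)`. For
`cd`-monomials `p` and `q` it is the weight of the lattice paths which start in the middle of a `d`
of the horizontal axis, in front of `p`, with a step which is not horizontal. -/
def defectLeft (p q : ABPoly) : ABPoly := diamond (vb * p) q - vb * diamond p q

/-- The defect of the left factor `b` on the right: `p ⋄ b q - b (p ⋄ q)`. -/
def defectRight (p q : ABPoly) : ABPoly := diamond p (vb * q) - vb * diamond p q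

theorem diamond_b_left (p q : ABPoly) :
    diamond (vb * p) q = defectLeft p q + vb * diamond p q := by
  rw [defectLeft, sub_add_cancel]

theorem diamond_b_right (p q : ABPoly) :
    diamond p (vb * q) = defectRight p q + vb * diamond p q := by
  rw [defectRight, sub_add_cancel]

theorem defectLeft_b (p q : ABPoly) :
    defectLeft p (vb * q) = vb * defectLeft p q + vb * va * diamond p q := by
  rw [defectLeft, diamond_b, diamond_b_left]
  noncomm_ring

theorem defectRight_b (p q : ABPoly) :
    defectRight (vb * p) q = vb * defectRight p q + vb * va * diamond p q := by
  rw [defectRight, diamond_b, diamond_b_right]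
  noncomm_ring

theorem defectLeft_a (p q : ABPoly) :
    defectLeft p (va * q) = (va - vb) * defectLeft p q + defectLeft p (vb * q) +
      (va * vb - vb * va) * diamond p q := by
  simp only [defectLeft, diamond_a_right]
  noncomm_ring

theorem defectRight_a (p q : ABPoly) :
    defectRight (va * p) q = (va - vb) * defectRight p q + defectRight (vb * p) q +
      (va * vb - vb * va) * diamond p q := by
  simp only [defectRight, diamond_a_left]
  noncomm_ring

theorem defectLeft_add_left (p p' q : ABPoly) :
    defectLeft (p + p') q = defectLeft p q + defectLeft p' q := by
  simp only [defectLeft, mul_add, map_add, LinearMap.add_apply]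
  abel

theorem defectLeft_add_right (p q q' : ABPoly) :
    defectLeft p (q + q') = defectLeft p q + defectLeft p q' := by
  simp only [defectLeft, map_add, mul_add]
  abel

theorem defectRight_add_left (p p' q : ABPoly) :
    defectRight (p + p') q = defectRight p q + defectRight p' q := by
  simp only [defectRight, mul_add, map_add, LinearMap.add_apply]
  abel

theorem defectLeft_one (p : ABPoly) : defectLeft p 1 = 0 := by
  rw [defectLeft, diamond_one_right, diamond_one_right, sub_self]

theorem defectRight_one (q : ABPoly) : defectRight 1 q = 0 := by
  rw [defectRight, diamond_one_left, diamond_one_left, sub_self]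

theorem defectLeft_c (p q : ABPoly) :
    defectLeft p (vc * q) = vc * defectLeft p q + vd * diamond p q := by
  rw [vc, add_mul, defectLeft_add_right, defectLeft_a, defectLeft_b, vd]
  noncomm_ring

theorem defectRight_c (p q : ABPoly) :
    defectRight (vc * p) q = vc * defectRight p q + vd * diamond p q := by
  rw [vc, add_mul, defectRight_add_left, defectRight_a, defectRight_b, vd]
  noncomm_ring

theorem defectLeft_d (p q : ABPoly) :
    defectLeft p (vd * q) =
      vd * (defectLeft p q + defectRight p q + vc * diamond p q) := by
  simp only [vd, vc, add_mul, mul_assoc, defectLeft_add_right, defectLeft_a, defectLeft_b,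
    diamond_a_right, diamond_b_right]
  noncomm_ring

theorem defectRight_d (p q : ABPoly) :
    defectRight (vd * p) q =
      vd * (defectLeft p q + defectRight p q + vc * diamond p q) := by
  simp only [vd, vc, add_mul, mul_assoc, defectRight_add_left, defectRight_a, defectRight_b,
    diamond_a_left, diamond_b_left]
  noncomm_ring

theorem diamond_c_left (p q : ABPoly) :
    diamond (vc * p) q = vc * diamond p q + 2 * defectLeft p q := by
  rw [vc, add_mul, map_add, LinearMap.add_apply, diamond_a_left, diamond_b_left]
  noncomm_ring

theorem diamond_c_right (p q : ABPoly) :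
    diamond p (vc * q) = vc * diamond p q + 2 * defectRight p q := by
  rw [vc, add_mul, map_add, diamond_a_right, diamond_b_right]
  noncomm_ring

theorem diamond_d_left (p q : ABPoly) :
    diamond (vd * p) q = vd * diamond p q + vc * defectLeft p q + defectLeft (vc * p) q := by
  simp only [vd, vc, add_mul, mul_assoc, map_add, LinearMap.add_apply, defectLeft_add_left,
    diamond_a_left, diamond_b_left]
  noncomm_ring

/-- The recursion for the last case, in which both monomials start with `d`. -/
theorem diamond_d_d (p q : ABPoly) :
    diamond (vd * p) (vd * q) = vd * diamond p (vd * q) + vd * diamond (vd * p) q +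
      (vc * vd + vd * vc) * (defectLeft p q + defectRight p q + vc * diamond p q) := by
  rw [diamond_d_left p (vd * q), defectLeft_d, defectLeft_d, defectRight_c, diamond_d_left p q,
    diamond_c_left]
  noncomm_ring

/-! ### Locally described lattice paths -/

/-- The rules for a step in terms of the labels `ℓ` and `m` of the unit intervals of the two axes
at its starting point and of the step after it. They include that the step does not start at the
end of an axis along which it runs, and the rule on `D R` in the form: no `D R` above a `d` of the
horizontal axis if `D` runs through the top half of a `d` of the vertical axis. -/
def IsAllowed (ℓ m : Option Label) (next : Option Step) : Step → Prop
  | Step.R => ℓ ≠ none ∧ (ℓ = some Label.dFirst → next ≠ some Step.R)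
  | Step.U => m ≠ none ∧ m ≠ some Label.dFirst ∧ next ≠ some Step.R ∧ next ≠ some Step.Rbar
  | Step.D => ℓ ≠ none ∧ m ≠ none ∧
      (ℓ = some Label.dFirst → m = some Label.dSecond → next ≠ some Step.R)
  | Step.Rbar => ℓ = some Label.dFirst
  | Step.Ubar => m = some Label.dFirst ∧ next ≠ some Step.R ∧ next ≠ some Step.Rbar

open Classical in
/-- The coefficient of a step, which is zero if the step is not allowed. -/
def stepCoeff (ℓ m : Option Label) (s : Step) (next : Option Step) : ℤ :=
  if IsAllowed ℓ m next s then
    if s = Step.D then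
      if ℓ = some Label.c ∧ (m = some Label.c ∨ m = some Label.dFirst) then 2
      else if ℓ = some Label.dFirst ∧ m = some Label.c ∧
          (next = some Step.U ∨ next = some Step.Ubar ∨ next = some Step.D) then 2
      else if ℓ = some Label.dFirst ∧ m = some Label.dFirst ∧ next = some Step.U then 2
      else 1
    else 1
  else 0

/-- The monomial in the weight of a step. -/
def stepMonomial : Step → ABPoly
  | Step.R => vc
  | Step.U => vc
  | Step.D => vd
  | Step.Rbar => vd
  | Step.Ubar => vd

open Classical in
/-- The weight of a list of steps read as a path which starts at a point from which the remaining
labels of the axes are `lu` and `lv`; it is zero if the path breaks a rule or does not end at the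
ends of both axes. -/
def tailWeight : List Label → List Label → List Step → ABPoly
  | lu, lv, [] => if lu = [] ∧ lv = [] then 1 else 0
  | lu, lv, s :: P => stepCoeff lu.head? lv.head? s P.head? •
      (stepMonomial s * tailWeight (lu.drop s.vec.1) (lv.drop s.vec.2) P)

/-- The sum of the weights of the paths through the remaining labels `lu` and `lv`, each one
multiplied by the value of `g` at its first step. -/
def pathSum (lu lv : List Label) (g : Option Step → ℤ) : ABPoly :=
  ∑ᶠ P : List Step, g P.head? • tailWeight lu lv P

theorem length_le_of_tailWeight_ne_zero {lu lv : List Label} {P : List Step}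
    (h : tailWeight lu lv P ≠ 0) : P.length ≤ lu.length + lv.length := by
  induction P generalizing lu lv with
  | nil => simp
  | cons s P ih =>
    rw [tailWeight] at h
    have h1 := ih (right_ne_zero_of_mul (right_ne_zero_of_smul h))
    have h2 : IsAllowed lu.head? lv.head? P.head? s := by
      by_contra hs
      exact left_ne_zero_of_smul h (by rw [stepCoeff, if_neg hs])
    simp only [List.length_drop] at h1
    rw [List.length_cons]
    cases s <;> cases lu <;> cases lv <;> simp [IsAllowed, Step.vec] at h1 h2 ⊢ <;> omega

theorem finite_support_tailWeight (lu lv : List Label) :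
    (Function.support (tailWeight lu lv)).Finite :=
  (List.finite_length_le Step (lu.length + lv.length)).subset
    fun _ h => length_le_of_tailWeight_ne_zero h

theorem finsum_step {M : Type*} [AddCommMonoid M] (f : Step → M) :
    ∑ᶠ s, f s = f Step.R + f Step.Rbar + f Step.U + f Step.Ubar + f Step.D := by
  classical
  have h : Function.support f ⊆
      (({Step.R, Step.Rbar, Step.U, Step.Ubar, Step.D} : Finset Step) : Set Step) := by
    intro s _
    cases s <;> simp
  rw [finsum_eq_sum_of_support_subset f h]
  simp [add_assoc]

theorem finsum_list {α M : Type*} [AddCommMonoid M] (f : List α → M)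
    (hf : (Function.support f).Finite) :
    ∑ᶠ P, f P = f [] + ∑ᶠ s, ∑ᶠ P, f (s :: P) := by
  let e : Option (α × List α) ≃ List α :=
    { toFun := fun o => o.elim [] fun x => x.1 :: x.2
      invFun := fun P => match P with
        | [] => none
        | s :: P => some (s, P)
      left_inv := by rintro (_ | ⟨s, P⟩) <;> rfl
      right_inv := by rintro (_ | ⟨s, P⟩) <;> rfl }
  have hfin : (Function.support fun x : α × List α => f (x.1 :: x.2)).Finite :=
    hf.preimage (f := fun x : α × List α => x.1 :: x.2) fun x _ y _ h => by
      obtain ⟨h1, h2⟩ := List.cons.inj h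
      exact Prod.ext h1 h2
  rw [← finsum_comp_equiv e, finsum_option (f := fun o => f (e o)) hfin,
    ← finsum_curry (fun x : α × List α => f (x.1 :: x.2)) hfin]
  rfl

open Classical in
theorem pathSum_eq (lu lv : List Label) (g : Option Step → ℤ) :
    pathSum lu lv g =
      (if lu = [] ∧ lv = [] then g none • 1 else 0) +
      (g (some Step.R) • (vc * pathSum (lu.drop 1) lv (stepCoeff lu.head? lv.head? Step.R)) +
      g (some Step.Rbar) • (vd * pathSum (lu.drop 2) lv (stepCoeff lu.head? lv.head? Step.Rbar)) +
      g (some Step.U) • (vc * pathSum lu (lv.drop 1) (stepCoeff lu.head? lv.head? Step.U)) +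
      g (some Step.Ubar) • (vd * pathSum lu (lv.drop 2) (stepCoeff lu.head? lv.head? Step.Ubar)) +
      g (some Step.D) •
        (vd * pathSum (lu.drop 1) (lv.drop 1) (stepCoeff lu.head? lv.head? Step.D))) := by
  have hs : ∀ s : Step,
      ∑ᶠ P : List Step, g (s :: P).head? • tailWeight lu lv (s :: P) =
        g (some s) • (stepMonomial s * pathSum (lu.drop s.vec.1) (lv.drop s.vec.2)
          (stepCoeff lu.head? lv.head? s)) := by
    intro s
    have hfin : (Function.support fun P : List Step => stepCoeff lu.head? lv.head? s P.head? •
        tailWeight (lu.drop s.vec.1) (lv.drop s.vec.2) P).Finite :=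
      (finite_support_tailWeight (lu.drop s.vec.1) (lv.drop s.vec.2)).subset
        fun P h => right_ne_zero_of_smul h
    rw [pathSum, mul_finsum' _ _ hfin, smul_finsum]
    refine finsum_congr fun P => ?_
    rw [tailWeight, mul_smul_comm]
    rfl
  rw [pathSum, finsum_list, finsum_congr hs, finsum_step]
  · congr 1
    rw [tailWeight]
    split_ifs <;> simp
  · exact (finite_support_tailWeight lu lv).subset fun P h => right_ne_zero_of_smul h

/-! ### Evaluation of the path sums -/

theorem cdWord_nil : cdWord [] = 1 := rfl

theorem cdWord_c (u : List CD) : cdWord (CD.c :: u) = vc * cdWord u := by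
  simp [cdWord]

theorem cdWord_d (u : List CD) : cdWord (CD.d :: u) = vd * cdWord u := by
  simp [cdWord]

/-- The part of `u ⋄ v` which comes from the paths that start with a horizontal step. -/
def horizontalPart : List CD → List CD → ABPoly
  | [], _ => 0
  | CD.c :: u, v => vc * diamond (cdWord u) (cdWord v)
  | CD.d :: u, v =>
      vd * diamond (cdWord u) (cdWord v) + vc * defectLeft (cdWord u) (cdWord v)

/-- The value of the path sum in front of the monomials `u` and `v`, for those `g` which only
distinguish horizontal steps (value `h`) from the others (value `t`). A `U` or `Ubar` step forces
`h = 0` for the path after it. -/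
def CornerFormula (u v : List CD) : Prop :=
  ∀ (g : Option Step → ℤ) (h t : ℤ), g none = t → g (some Step.R) = h →
    g (some Step.Rbar) = h → g (some Step.U) = t → g (some Step.Ubar) = t →
    g (some Step.D) = t → pathSum (labels u) (labels v) g =
      h • horizontalPart u v + t • (diamond (cdWord u) (cdWord v) - horizontalPart u v)

/-- The value of the path sum in the middle of a `d` of the horizontal axis which is followed
by `u`. An `Rbar` step is not allowed there, so that the value of `g` at it is irrelevant. -/
def MidHorizontalFormula (u v : List CD) : Prop :=
  ∀ (g : Option Step → ℤ) (h t : ℤ), g (some Step.R) = h →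
    g (some Step.U) = t → g (some Step.Ubar) = t → g (some Step.D) = t →
    pathSum (Label.dSecond :: labels u) (labels v) g =
      h • (vc * diamond (cdWord u) (cdWord v)) + t • defectLeft (cdWord u) (cdWord v)

/-- The value of the path sum in the middle of a `d` of the vertical axis which is followed
by `v`. Such a point is reached by a `D` step or by a horizontal step, and none of these
restricts the step after it if it ends in front of a letter of the horizontal axis. -/
def MidVerticalFormula (u v : List CD) : Prop :=
  ∀ (g : Option Step → ℤ) (t : ℤ), g (some Step.R) = t →
    g (some Step.Rbar) = t → g (some Step.U) = t → g (some Step.D) = t →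
    pathSum (labels u) (Label.dSecond :: labels v) g =
      t • (vc * diamond (cdWord u) (cdWord v) + defectRight (cdWord u) (cdWord v))

/-- The value of the path sum in the middle of a `d` of each axis, where only the steps `R`, `U`
and `D` are allowed. -/
def MidBothFormula (u v : List CD) : Prop :=
  ∀ (g : Option Step → ℤ) (h t r : ℤ), g (some Step.R) = h →
    g (some Step.U) = t → g (some Step.D) = r →
    pathSum (Label.dSecond :: labels u) (Label.dSecond :: labels v) g =
      h • (vc * (vc * diamond (cdWord u) (cdWord v) + defectRight (cdWord u) (cdWord v))) +
      t • (vc * defectLeft (cdWord u) (cdWord v)) + r • (vd * diamond (cdWord u) (cdWord v))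

/-! In the proofs of these formulas, `pathSum_eq` splits off the first step, in the order `R`,
`Rbar`, `U`, `Ubar`, `D`. The path sum after a step is evaluated at the function `stepCoeff` of that
step, whose values are the numerals in the `rw` call: `0` at a next step which is forbidden, and `2`
where the coefficient of `D` is doubled. Steps which are not allowed at all have the zero function.
What remains is the recursion for the diamond product. -/

theorem pathSum_eq_zero (lu lv : List Label) (g : Option Step → ℤ) (h : ∀ o, g o = 0) :
    pathSum lu lv g = 0 := by
  simp [pathSum, h]

theorem cornerFormula_nil_nil : CornerFormula [] [] := by
  intro g h t e1 _ _ _ _ _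
  rw [pathSum_eq]
  simp only [labels, List.head?_nil, List.drop_nil]
  iterate 5 rw [pathSum_eq_zero _ _ (stepCoeff none none _)]
  on_goal 1 => simp [horizontalPart, cdWord_nil, diamond_one_left, e1]
  all_goals simp [stepCoeff, IsAllowed]

theorem cornerFormula_nil_c {v : List CD} (h1 : CornerFormula [] v) :
    CornerFormula [] (CD.c :: v) := by
  intro g h t _ e1 e2 e3 e4 e5
  rw [pathSum_eq]
  simp only [labels, CornerFormula, List.head?_cons, List.head?_nil, List.drop_succ_cons,
    List.drop_zero, List.drop_nil] at *
  rw [pathSum_eq_zero _ _ (stepCoeff _ _ Step.R), pathSum_eq_zero _ _ (stepCoeff _ _ Step.Rbar),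
    h1 _ 0 1, pathSum_eq_zero _ _ (stepCoeff _ _ Step.Ubar),
    pathSum_eq_zero _ _ (stepCoeff _ _ Step.D)]
  on_goal 1 =>
    simp only [horizontalPart, cdWord_nil, cdWord_c, diamond_one_left, diamond_c_right,
      defectRight_one, e1, e2, e3, e4, e5]
    simp
  all_goals simp [stepCoeff, IsAllowed]

theorem cornerFormula_nil_d {v : List CD} (h1 : CornerFormula [] v) :
    CornerFormula [] (CD.d :: v) := by
  intro g h t _ e1 e2 e3 e4 e5
  rw [pathSum_eq]
  simp only [labels, CornerFormula, List.head?_cons, List.head?_nil, List.drop_succ_cons,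
    List.drop_zero, List.drop_nil] at *
  rw [pathSum_eq_zero _ _ (stepCoeff _ _ Step.R), pathSum_eq_zero _ _ (stepCoeff _ _ Step.Rbar),
    pathSum_eq_zero _ _ (stepCoeff _ _ Step.U), h1 _ 0 1,
    pathSum_eq_zero _ _ (stepCoeff _ _ Step.D)]
  on_goal 1 =>
    simp only [horizontalPart, cdWord_nil, cdWord_d, diamond_one_left, e1, e2, e3, e4, e5]
    simp
  all_goals simp [stepCoeff, IsAllowed]

theorem cornerFormula_c_nil {u : List CD} (h1 : CornerFormula u []) :
    CornerFormula (CD.c :: u) [] := by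
  intro g h t _ e1 e2 e3 e4 e5
  rw [pathSum_eq]
  simp only [labels, CornerFormula, List.head?_cons, List.head?_nil, List.drop_succ_cons,
    List.drop_zero, List.drop_nil] at *
  rw [h1 _ 1 1, pathSum_eq_zero _ _ (stepCoeff _ _ Step.Rbar),
    pathSum_eq_zero _ _ (stepCoeff _ _ Step.U), pathSum_eq_zero _ _ (stepCoeff _ _ Step.Ubar),
    pathSum_eq_zero _ _ (stepCoeff _ _ Step.D)]
  on_goal 1 =>
    simp only [horizontalPart, cdWord_nil, cdWord_c, diamond_one_right, e1, e2, e3, e4, e5]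
    simp
  all_goals simp [stepCoeff, IsAllowed]

theorem cornerFormula_d_nil {u : List CD} (h1 : CornerFormula u [])
    (h2 : MidHorizontalFormula u []) : CornerFormula (CD.d :: u) [] := by
  intro g h t _ e1 e2 e3 e4 e5
  rw [pathSum_eq]
  simp only [labels, CornerFormula, MidHorizontalFormula, List.head?_cons, List.head?_nil,
    List.drop_succ_cons, List.drop_zero, List.drop_nil] at *
  rw [h2 _ 0 1, h1 _ 1 1, pathSum_eq_zero _ _ (stepCoeff _ _ Step.U),
    pathSum_eq_zero _ _ (stepCoeff _ _ Step.Ubar), pathSum_eq_zero _ _ (stepCoeff _ _ Step.D)]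
  on_goal 1 =>
    simp only [horizontalPart, cdWord_nil, cdWord_d, diamond_one_right, defectLeft_one, e1, e2, e3,
      e4, e5]
    simp
  all_goals simp [stepCoeff, IsAllowed]

theorem cornerFormula_c_c {u v : List CD} (h1 : CornerFormula u (CD.c :: v))
    (h2 : CornerFormula (CD.c :: u) v) (h3 : CornerFormula u v) :
    CornerFormula (CD.c :: u) (CD.c :: v) := by
  intro g h t _ e1 e2 e3 e4 e5
  rw [pathSum_eq]
  simp only [labels, CornerFormula, List.head?_cons, List.drop_succ_cons, List.drop_zero] at *
  rw [h1 _ 1 1, pathSum_eq_zero _ _ (stepCoeff _ _ Step.Rbar), h2 _ 0 1,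
    pathSum_eq_zero _ _ (stepCoeff _ _ Step.Ubar), h3 _ 2 2]
  on_goal 1 =>
    simp only [horizontalPart, cdWord_c, diamond_c_left, diamond_c_right, defectRight_c, e1, e2, e3,
      e4, e5]
    simp [two_mul, mul_add, mul_sub]
    module
  all_goals simp [stepCoeff, IsAllowed]

theorem cornerFormula_c_d {u v : List CD} (h1 : CornerFormula u (CD.d :: v))
    (h2 : CornerFormula (CD.c :: u) v) (h3 : MidVerticalFormula u v) :
    CornerFormula (CD.c :: u) (CD.d :: v) := by
  intro g h t _ e1 e2 e3 e4 e5
  rw [pathSum_eq]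
  simp only [labels, CornerFormula, MidVerticalFormula, List.head?_cons, List.drop_succ_cons,
    List.drop_zero] at *
  rw [h1 _ 1 1, pathSum_eq_zero _ _ (stepCoeff _ _ Step.Rbar),
    pathSum_eq_zero _ _ (stepCoeff _ _ Step.U), h2 _ 0 1, h3 _ 2]
  on_goal 1 =>
    simp only [horizontalPart, cdWord_c, cdWord_d, diamond_c_left, defectLeft_d, e1, e2, e3, e4, e5]
    simp [two_mul, mul_add]
    module
  all_goals simp [stepCoeff, IsAllowed]

theorem cornerFormula_d_c {u v : List CD} (h1 : MidHorizontalFormula u (CD.c :: v))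
    (h2 : CornerFormula u (CD.c :: v)) (h3 : CornerFormula (CD.d :: u) v)
    (h4 : MidHorizontalFormula u v) : CornerFormula (CD.d :: u) (CD.c :: v) := by
  intro g h t _ e1 e2 e3 e4 e5
  rw [pathSum_eq]
  simp only [labels, CornerFormula, MidHorizontalFormula, List.head?_cons, List.drop_succ_cons,
    List.drop_zero] at *
  rw [h1 _ 0 1, h2 _ 1 1, h3 _ 0 1, pathSum_eq_zero _ _ (stepCoeff _ _ Step.Ubar), h4 _ 1 2]
  on_goal 1 =>
    simp only [horizontalPart, cdWord_c, cdWord_d, diamond_c_right, defectLeft_c, defectRight_d, e1,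
      e2, e3, e4, e5]
    simp [two_mul, mul_add, mul_sub]
    module
  all_goals simp [stepCoeff, IsAllowed]

theorem cornerFormula_d_d {u v : List CD} (h1 : MidHorizontalFormula u (CD.d :: v))
    (h2 : CornerFormula u (CD.d :: v)) (h3 : CornerFormula (CD.d :: u) v)
    (h4 : MidBothFormula u v) : CornerFormula (CD.d :: u) (CD.d :: v) := by
  intro g h t _ e1 e2 e3 e4 e5
  rw [pathSum_eq]
  simp only [labels, CornerFormula, MidHorizontalFormula, MidBothFormula, List.head?_cons,
    List.drop_succ_cons, List.drop_zero] at *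
  rw [h1 _ 0 1, h2 _ 1 1, pathSum_eq_zero _ _ (stepCoeff _ _ Step.U), h3 _ 0 1, h4 _ 1 2 1]
  on_goal 1 =>
    simp only [horizontalPart, cdWord_d, diamond_d_d, defectLeft_d, e1, e2, e3, e4, e5]
    simp [two_mul, mul_add, mul_sub, add_mul, mul_assoc]
    module
  all_goals simp [stepCoeff, IsAllowed]

theorem midHorizontalFormula_right_nil {u : List CD} (h1 : CornerFormula u []) :
    MidHorizontalFormula u [] := by
  intro g h t e1 e3 e4 e5
  rw [pathSum_eq]
  simp only [labels, CornerFormula, List.head?_cons, List.head?_nil, List.drop_succ_cons,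
    List.drop_zero, List.drop_nil] at *
  rw [h1 _ 1 1, pathSum_eq_zero _ _ (stepCoeff _ _ Step.Rbar),
    pathSum_eq_zero _ _ (stepCoeff _ _ Step.U), pathSum_eq_zero _ _ (stepCoeff _ _ Step.Ubar),
    pathSum_eq_zero _ _ (stepCoeff _ _ Step.D)]
  on_goal 1 =>
    simp only [horizontalPart, cdWord_nil, diamond_one_right, defectLeft_one, e1, e3, e4, e5]
    simp
  all_goals simp [stepCoeff, IsAllowed]

theorem midHorizontalFormula_right_c {u v : List CD} (h1 : CornerFormula u (CD.c :: v))
    (h2 : MidHorizontalFormula u v) (h3 : CornerFormula u v) :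
    MidHorizontalFormula u (CD.c :: v) := by
  intro g h t e1 e3 e4 e5
  rw [pathSum_eq]
  simp only [labels, CornerFormula, MidHorizontalFormula, List.head?_cons, List.drop_succ_cons,
    List.drop_zero] at *
  rw [h1 _ 1 1, pathSum_eq_zero _ _ (stepCoeff _ _ Step.Rbar), h2 _ 0 1,
    pathSum_eq_zero _ _ (stepCoeff _ _ Step.Ubar), h3 _ 1 1]
  on_goal 1 =>
    simp only [horizontalPart, cdWord_c, diamond_c_right, defectLeft_c, e1, e3, e4, e5]
    simp [two_mul, mul_add]
    module
  all_goals simp [stepCoeff, IsAllowed]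

theorem midHorizontalFormula_right_d {u v : List CD} (h1 : CornerFormula u (CD.d :: v))
    (h2 : MidHorizontalFormula u v) (h3 : MidVerticalFormula u v) :
    MidHorizontalFormula u (CD.d :: v) := by
  intro g h t e1 e3 e4 e5
  rw [pathSum_eq]
  simp only [labels, CornerFormula, MidHorizontalFormula, MidVerticalFormula, List.head?_cons,
    List.drop_succ_cons, List.drop_zero] at *
  rw [h1 _ 1 1, pathSum_eq_zero _ _ (stepCoeff _ _ Step.Rbar),
    pathSum_eq_zero _ _ (stepCoeff _ _ Step.U), h2 _ 0 1, h3 _ 1]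
  on_goal 1 =>
    simp only [horizontalPart, cdWord_d, defectLeft_d, e1, e3, e4, e5]
    simp [mul_add]
    module
  all_goals simp [stepCoeff, IsAllowed]

theorem midVerticalFormula_left_nil {v : List CD} (h1 : CornerFormula [] v) :
    MidVerticalFormula [] v := by
  intro g t e1 e2 e3 e5
  rw [pathSum_eq]
  simp only [labels, CornerFormula, List.head?_cons, List.head?_nil, List.drop_succ_cons,
    List.drop_zero, List.drop_nil] at *
  rw [pathSum_eq_zero _ _ (stepCoeff _ _ Step.R), pathSum_eq_zero _ _ (stepCoeff _ _ Step.Rbar),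
    h1 _ 0 1, pathSum_eq_zero _ _ (stepCoeff _ _ Step.Ubar),
    pathSum_eq_zero _ _ (stepCoeff _ _ Step.D)]
  on_goal 1 =>
    simp only [horizontalPart, cdWord_nil, diamond_one_left, defectRight_one, e1, e2, e3, e5]
    simp
  all_goals simp [stepCoeff, IsAllowed]

theorem midVerticalFormula_left_c {u v : List CD} (h1 : MidVerticalFormula u v)
    (h2 : CornerFormula (CD.c :: u) v) (h3 : CornerFormula u v) :
    MidVerticalFormula (CD.c :: u) v := by
  intro g t e1 e2 e3 e5
  rw [pathSum_eq]
  simp only [labels, CornerFormula, MidVerticalFormula, List.head?_cons, List.drop_succ_cons,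
    List.drop_zero] at *
  rw [h1 _ 1, pathSum_eq_zero _ _ (stepCoeff _ _ Step.Rbar), h2 _ 0 1,
    pathSum_eq_zero _ _ (stepCoeff _ _ Step.Ubar), h3 _ 1 1]
  on_goal 1 =>
    simp only [horizontalPart, cdWord_c, diamond_c_left, defectRight_c, e1, e2, e3, e5]
    simp [two_mul, mul_add]
    module
  all_goals simp [stepCoeff, IsAllowed]

theorem midVerticalFormula_left_d {u v : List CD} (h1 : MidBothFormula u v)
    (h2 : MidVerticalFormula u v) (h3 : CornerFormula (CD.d :: u) v)
    (h4 : MidHorizontalFormula u v) : MidVerticalFormula (CD.d :: u) v := by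
  intro g t e1 e2 e3 e5
  rw [pathSum_eq]
  simp only [labels, CornerFormula, MidHorizontalFormula, MidVerticalFormula, MidBothFormula,
    List.head?_cons, List.drop_succ_cons, List.drop_zero] at *
  rw [h1 _ 0 1 1, h2 _ 1, h3 _ 0 1, pathSum_eq_zero _ _ (stepCoeff _ _ Step.Ubar), h4 _ 0 1]
  on_goal 1 =>
    simp only [horizontalPart, cdWord_d, defectRight_d, e1, e2, e3, e5]
    simp [mul_add, mul_sub]
    module
  all_goals simp [stepCoeff, IsAllowed]

theorem midBothFormula_of_formulas {u v : List CD} (h1 : MidVerticalFormula u v)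
    (h2 : MidHorizontalFormula u v) (h3 : CornerFormula u v) : MidBothFormula u v := by
  intro g h t r e1 e3 e5
  rw [pathSum_eq]
  simp only [CornerFormula, MidHorizontalFormula, MidVerticalFormula, List.head?_cons,
    List.drop_succ_cons, List.drop_zero] at *
  rw [h1 _ 1, pathSum_eq_zero _ _ (stepCoeff _ _ Step.Rbar), h2 _ 0 1,
    pathSum_eq_zero _ _ (stepCoeff _ _ Step.Ubar), h3 _ 1 1]
  on_goal 1 =>
    simp only [horizontalPart, e1, e3, e5]
    simp [mul_add]
  all_goals simp [stepCoeff, IsAllowed]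

/-- The path sums of all four kinds of starting points. -/
structure PathSumFormulas (u v : List CD) : Prop where
  corner : CornerFormula u v
  midHorizontal : MidHorizontalFormula u v
  midVertical : MidVerticalFormula u v
  midBoth : MidBothFormula u v

theorem pathSumFormulas (u v : List CD) : PathSumFormulas u v := by
  have mk : ∀ {u v : List CD}, CornerFormula u v → MidHorizontalFormula u v →
      MidVerticalFormula u v → PathSumFormulas u v := fun hc hh hv =>
    ⟨hc, hh, hv, midBothFormula_of_formulas hv hh hc⟩
  induction u generalizing v with
  | nil =>
    induction v with
    | nil =>
      have hc := cornerFormula_nil_nil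
      exact mk hc (midHorizontalFormula_right_nil hc) (midVerticalFormula_left_nil hc)
    | cons y v ih =>
      cases y with
      | c =>
        have hc := cornerFormula_nil_c ih.corner
        exact mk hc (midHorizontalFormula_right_c hc ih.midHorizontal ih.corner)
          (midVerticalFormula_left_nil hc)
      | d =>
        have hc := cornerFormula_nil_d ih.corner
        exact mk hc (midHorizontalFormula_right_d hc ih.midHorizontal ih.midVertical)
          (midVerticalFormula_left_nil hc)
  | cons x u ihu =>
    induction v with
    | nil =>
      have h := ihu []
      cases x with
      | c =>
        have hc := cornerFormula_c_nil h.corner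
        exact mk hc (midHorizontalFormula_right_nil hc)
          (midVerticalFormula_left_c h.midVertical hc h.corner)
      | d =>
        have hc := cornerFormula_d_nil h.corner h.midHorizontal
        exact mk hc (midHorizontalFormula_right_nil hc)
          (midVerticalFormula_left_d h.midBoth h.midVertical hc h.midHorizontal)
    | cons y v ihv =>
      have h0 := ihu v
      have h := ihu (y :: v)
      have hc : CornerFormula (x :: u) (y :: v) := by
        cases x <;> cases y
        · exact cornerFormula_c_c h.corner ihv.corner h0.corner
        · exact cornerFormula_c_d h.corner ihv.corner h0.midVertical
        · exact cornerFormula_d_c h.midHorizontal h.corner ihv.corner h0.midHorizontal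
        · exact cornerFormula_d_d h.midHorizontal h.corner ihv.corner h0.midBoth
      refine mk hc ?_ ?_
      · cases y
        · exact midHorizontalFormula_right_c hc ihv.midHorizontal ihv.corner
        · exact midHorizontalFormula_right_d hc ihv.midHorizontal ihv.midVertical
      · cases x
        · exact midVerticalFormula_left_c h.midVertical hc h.corner
        · exact midVerticalFormula_left_d h.midBoth h.midVertical hc h.midHorizontal

theorem pathSum_labels (u v : List CD) :
    pathSum (labels u) (labels v) (fun _ => 1) = diamond (cdWord u) (cdWord v) := by
  rw [(pathSumFormulas u v).corner _ 1 1 rfl rfl rfl rfl rfl rfl, one_smul, one_smul,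
    add_sub_cancel]

/-! ### Comparison with the labeled paths -/

theorem length_labels (u : List CD) : (labels u).length = deg u := by
  induction u with
  | nil => rfl
  | cons x u ih => cases x <;> simp [labels, deg, ih]

theorem not_hasLabel_zero_dSecond (v : List CD) : ¬ HasLabel v 0 Label.dSecond := by
  cases v with
  | nil => simp [HasLabel, labels]
  | cons x v => cases x <;> simp [HasLabel, labels]

theorem hasLabel_succ_dSecond {v : List CD} {i : ℕ} :
    HasLabel v (i + 1) Label.dSecond ↔ HasLabel v i Label.dFirst := by
  induction v generalizing i with
  | nil => simp [HasLabel, labels]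
  | cons x v ih =>
    have h0 := not_hasLabel_zero_dSecond v
    cases x with
    | c =>
      cases i with
      | zero => simpa [HasLabel, labels] using h0
      | succ i => simpa [HasLabel, labels] using ih
    | d =>
      match i with
      | 0 => simp [HasLabel, labels]
      | 1 => simpa [HasLabel, labels] using h0
      | i + 2 => simpa [HasLabel, labels] using ih

theorem lt_deg_of_getElem?_labels {u : List CD} {i : ℕ} : (labels u)[i]? ≠ none ↔ i < deg u := by
  rw [← length_labels]
  simp

theorem endpoint_append (A B : List Step) : endpoint (A ++ B) = endpoint A + endpoint B := by
  simp [endpoint]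

theorem endpoint_cons (s : Step) (B : List Step) : endpoint (s :: B) = s.vec + endpoint B := by
  simp [endpoint]

/-- The path `P`, started at `z`, ends at the ends of both axes, and each of its steps satisfies
`IsAllowed`. -/
def IsLocalPath (u v : List CD) : ℕ × ℕ → List Step → Prop
  | z, [] => z = (deg u, deg v)
  | z, s :: P => IsAllowed (labels u)[z.1]? (labels v)[z.2]? P.head? s ∧
      IsLocalPath u v (z + s.vec) P

theorem isLocalPath_iff {u v : List CD} {z : ℕ × ℕ} {P : List Step} :
    IsLocalPath u v z P ↔ z + endpoint P = (deg u, deg v) ∧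
      ∀ (A B : List Step) (s : Step), P = A ++ s :: B →
        IsAllowed (labels u)[(z + endpoint A).1]? (labels v)[(z + endpoint A).2]? B.head? s := by
  induction P generalizing z with
  | nil => simp [IsLocalPath, endpoint]
  | cons s P ih =>
    rw [IsLocalPath, ih, endpoint_cons, ← add_assoc]
    constructor
    · rintro ⟨h1, h2, h3⟩
      refine ⟨h2, fun A B t h => ?_⟩
      cases A with
      | nil =>
        obtain ⟨rfl, rfl⟩ := List.cons.inj h
        simpa [endpoint] using h1
      | cons a A =>
        obtain ⟨rfl, hP⟩ := List.cons.inj h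
        rw [endpoint_cons, ← add_assoc]
        exact h3 A B t hP
    · rintro ⟨h2, h3⟩
      refine ⟨by simpa [endpoint] using h3 [] P s rfl, h2, fun A B t h => ?_⟩
      have := h3 (s :: A) B t (by rw [h]; rfl)
      rwa [endpoint_cons, ← add_assoc] at this

/-- A labeled path gets to the height of the middle of a vertical `d` only by a `D` step: `U` does
not start at the bottom of this `d`, and `Ubar` passes over its middle. -/
theorem IsLabeledPath.exists_diagonal {u v : List CD} {P : List Step} (h : IsLabeledPath u v P)
    {A B : List Step} (hP : P = A ++ B) (hA : HasLabel v (endpoint A).2 Label.dSecond) :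
    ∃ A₁ B₁, A = A₁ ++ Step.D :: B₁ ∧ HasLabel v (endpoint A₁).2 Label.dFirst ∧
      (endpoint A).2 = (endpoint A₁).2 + 1 := by
  induction A using List.reverseRecOn generalizing B with
  | nil => exact absurd hA (not_hasLabel_zero_dSecond v)
  | append_singleton A s ih =>
    have hP' : P = A ++ s :: B := by rw [hP]; simp
    have hend : (endpoint (A ++ [s])).2 = (endpoint A).2 + s.vec.2 := by
      rw [endpoint_append, endpoint_cons]
      simp [endpoint]
    rw [hend] at hA ⊢
    cases s with
    | R =>
      obtain ⟨A₁, B₁, h1, h2, h3⟩ := ih hP' hA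
      exact ⟨A₁, B₁ ++ [Step.R], by rw [h1]; simp, h2, h3⟩
    | Rbar =>
      obtain ⟨A₁, B₁, h1, h2, h3⟩ := ih hP' hA
      exact ⟨A₁, B₁ ++ [Step.Rbar], by rw [h1]; simp, h2, h3⟩
    | D => exact ⟨A, [], rfl, hasLabel_succ_dSecond.1 hA, rfl⟩
    | U => exact absurd (hasLabel_succ_dSecond.1 hA) (h.rule_one A B hP')
    | Ubar =>
      have h1 := hasLabel_succ_dSecond.2 (h.rule_three_up A B hP')
      have h2 := (hasLabel_succ_dSecond (i := (endpoint A).2 + 1)).1 hA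
      rw [HasLabel] at h1 h2
      simp [h1] at h2

theorem eq_cons_of_head? {α : Type*} {B : List α} {t : α} (h : B.head? = some t) :
    B = t :: B.tail :=
  (List.cons_head?_tail h).symm

theorem isLabeledPath_iff {u v : List CD} {P : List Step} :
    IsLabeledPath u v P ↔ IsLocalPath u v (0, 0) P := by
  have h0 : ∀ z : ℕ × ℕ, (0, 0) + z = z := zero_add
  simp only [isLocalPath_iff, h0]
  constructor
  · intro h
    refine ⟨h.isPath.endpoint_eq, fun A B s hP => ?_⟩
    have hend := h.isPath.endpoint_eq
    rw [hP, endpoint_append, endpoint_cons] at hend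
    have hend1 := congrArg Prod.fst hend
    have hend2 := congrArg Prod.snd hend
    simp only [Prod.fst_add, Prod.snd_add] at hend1 hend2
    have hup : s = Step.U ∨ s = Step.Ubar →
        B.head? ≠ some Step.R ∧ B.head? ≠ some Step.Rbar := by
      intro hs
      constructor <;> intro hB <;> rw [eq_cons_of_head? hB] at hP
      · exact h.isPath.no_factor _ _ _ _ hP hs (Or.inl rfl)
      · exact h.isPath.no_factor _ _ _ _ hP hs (Or.inr rfl)
    cases s with
    | R =>
      simp only [Step.vec] at hend1
      refine ⟨lt_deg_of_getElem?_labels.2 (by omega), fun h1 hB => ?_⟩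
      rw [eq_cons_of_head? hB] at hP
      exact h.rule_two _ _ hP h1
    | U =>
      simp only [Step.vec] at hend2
      exact ⟨lt_deg_of_getElem?_labels.2 (by omega), h.rule_one _ _ hP, hup (Or.inl rfl)⟩
    | D =>
      simp only [Step.vec] at hend1 hend2
      refine ⟨lt_deg_of_getElem?_labels.2 (by omega), lt_deg_of_getElem?_labels.2 (by omega),
        fun h1 h2 hB => ?_⟩
      obtain ⟨A₁, B₁, hA, h3, h4⟩ := h.exists_diagonal hP h2
      rw [eq_cons_of_head? hB, hA] at hP
      rw [hA] at h1 h4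
      exact h.rule_four _ _ _ hP h3 h4 h1
    | Rbar => exact h.rule_three_right _ _ hP
    | Ubar => exact ⟨h.rule_three_up _ _ hP, hup (Or.inr rfl)⟩
  · rintro ⟨hend, h⟩
    refine ⟨⟨hend, ?_⟩, ?_, ?_, ?_, ?_, ?_⟩
    · rintro A B s t hP (rfl | rfl) (rfl | rfl)
      · exact (h _ _ _ hP).2.2.1 rfl
      · exact (h _ _ _ hP).2.2.2 rfl
      · exact (h _ _ _ hP).2.1 rfl
      · exact (h _ _ _ hP).2.2 rfl
    · exact fun A B hP => (h _ _ _ hP).2.1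
    · exact fun A B hP h1 => (h _ _ _ hP).2 h1 rfl
    · exact fun A B hP => (h _ _ _ hP).1
    · exact fun A B hP => h _ _ _ hP
    · intro A B C hP h1 h2 h3
      refine (h _ _ _ hP).2.2 h3 ?_ rfl
      rw [h2]
      exact hasLabel_succ_dSecond.2 h1

theorem stepCoeff_smul_stepMonomial {u v : List CD} {z : ℕ × ℕ} {next : Option Step} {s : Step}
    (h : IsAllowed (labels u)[z.1]? (labels v)[z.2]? next s) :
    stepCoeff (labels u)[z.1]? (labels v)[z.2]? s next • stepMonomial s =
      stepWeight u v z.1 z.2 next s := by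
  rw [stepCoeff, if_pos h]
  cases s with
  | D =>
    simp only [stepMonomial, stepWeight, diagCoeff, HasLabel, if_true]
    congr
  | _ => simp [stepMonomial, stepWeight]

theorem le_deg_of_isAllowed {u v : List CD} {z : ℕ × ℕ} {next : Option Step} {s : Step}
    (hz1 : z.1 ≤ deg u) (hz2 : z.2 ≤ deg v)
    (h : IsAllowed (labels u)[z.1]? (labels v)[z.2]? next s) :
    (z + s.vec).1 ≤ deg u ∧ (z + s.vec).2 ≤ deg v := by
  have hd : ∀ (w : List CD) (i : ℕ), (labels w)[i]? = some Label.dFirst → i + 2 ≤ deg w := by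
    intro w i hi
    have h1 : (labels w)[i + 1]? = some Label.dSecond := hasLabel_succ_dSecond.2 hi
    exact lt_deg_of_getElem?_labels.1 (by rw [h1]; simp)
  cases s with
  | R => exact ⟨lt_deg_of_getElem?_labels.1 h.1, hz2⟩
  | U => exact ⟨hz1, lt_deg_of_getElem?_labels.1 h.1⟩
  | D => exact ⟨lt_deg_of_getElem?_labels.1 h.1, lt_deg_of_getElem?_labels.1 h.2.1⟩
  | Rbar => exact ⟨hd _ _ h, hz2⟩
  | Ubar => exact ⟨hz1, hd _ _ h.1⟩

open Classical in
theorem tailWeight_drop_labels {u v : List CD} (z : ℕ × ℕ) (hz1 : z.1 ≤ deg u) (hz2 : z.2 ≤ deg v)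
    (P : List Step) : tailWeight ((labels u).drop z.1) ((labels v).drop z.2) P =
      if IsLocalPath u v z P then weightFrom u v z P else 0 := by
  induction P generalizing z with
  | nil =>
    have h : ((labels u).drop z.1 = [] ∧ (labels v).drop z.2 = []) ↔ z = (deg u, deg v) := by
      rw [List.drop_eq_nil_iff, List.drop_eq_nil_iff, length_labels, length_labels, Prod.ext_iff]
      simp only
      omega
    simp only [tailWeight, IsLocalPath, weightFrom, h]
    congr
  | cons s P ih =>
    rw [tailWeight, IsLocalPath, weightFrom, List.head?_drop, List.head?_drop, List.drop_drop,
      List.drop_drop]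
    by_cases h : IsAllowed (labels u)[z.1]? (labels v)[z.2]? P.head? s
    · obtain ⟨h1, h2⟩ := le_deg_of_isAllowed hz1 hz2 h
      rw [← smul_mul_assoc, stepCoeff_smul_stepMonomial h]
      have := ih (z + s.vec) h1 h2
      rw [Prod.fst_add, Prod.snd_add] at this
      rw [this]
      simp [h]
    · rw [if_neg fun h' => h h'.1, stepCoeff, if_neg h, zero_smul]

theorem sum_weight_eq_pathSum (u v : List CD) :
    ∑ P ∈ (gamma_finite u v).toFinset, weight u v P =
      pathSum (labels u) (labels v) fun _ => 1 := by
  classical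
  have h : ∀ P : List Step, (1 : ℤ) • tailWeight (labels u) (labels v) P =
      if P ∈ Gamma u v then weight u v P else 0 := by
    intro P
    have := tailWeight_drop_labels (u := u) (v := v) (0, 0) (Nat.zero_le _) (Nat.zero_le _) P
    simp only [List.drop_zero] at this
    rw [one_smul, this, ← isLabeledPath_iff]
    rfl
  rw [pathSum, finsum_congr h, finsum_eq_sum_of_support_subset (s := (gamma_finite u v).toFinset)]
  · refine Finset.sum_congr rfl fun P hP => ?_
    rw [if_pos ((gamma_finite u v).mem_toFinset.1 hP)]
  · intro P hP
    by_contra hP'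
    rw [Set.Finite.coe_toFinset] at hP'
    exact hP (if_neg hP')

end CDDiamond

end

theorem theorem3 (u v : List CDDiamond.CD) :
    CDDiamond.diamond (CDDiamond.cdWord u) (CDDiamond.cdWord v) =
      ∑ P ∈ (CDDiamond.gamma_finite u v).toFinset, CDDiamond.weight u v P := by
  rw [CDDiamond.sum_weight_eq_pathSum, CDDiamond.pathSum_labels]
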